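/- **Conventions.** Data are finite binary trees (read as nested lists); the length of a datum is its number of nodes. The elements of a group, words and presentations are encoded by data. A *black box group* $G$ is a group together with an encoding of its elements by data of length bounded by some number (an element may have several codes, so $G$ is finite) and deterministic algorithms for multiplication, inversion and testing equality on codes. A *map of black box groups* is a group homomorphism $f\colon G\to H$ together with deterministic algorithms that compute a code of $f(g)$ from a code of $g$ and, from a code of an element $h\in\operatorname{im}(f)$, a code of some $g$ with $f(g)=h$. A finite presentation $P=\langle X\mid T\rangle$ is given by the number $|X|$ of generators and a list $T$ of $|T|$ relators; words over $X\cup X^{-1}$ are written with binary exponents (generators are named and counted in unary). An *effective presentation* of a black box group $G$ consists of a finite presentation $P$, a probabilistic algorithm $\alpha$ that computes a word $\alpha(g)\in(X\cup X^{-1})^*$ from a code of $g\in G$, and a probabilistic algorithm $\alpha^{-1}$ that computes a code of an element $\alpha^{-1}(w)\in G$ from a word $w\in(X\cup X^{-1})^*$, such that there is an isomorphism $G\to P$ which maps $g$ to the class of $\alpha(g)$, for every outcome of the computation, and whose inverse maps the class of $w$ to $\alpha^{-1}(w)$, for every outcome. Programs operate on registers holding data, with cost proportional to the amount of data moved; they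 use no randomness of their own, but may call given algorithms as subroutines, paying for the query, the running time of the subroutine and the answer. Times of probabilistic algorithms are expected times. **Theorem.** There are programs $\mathtt{construct}$, $\mathtt{log}$ and $\mathtt{exp}$ with the following property. For every polynomial $p$ there is a polynomial $q$ such that the following holds for every $s\in\mathbb N$, every exact sequence \[ 1 \longrightarrow N \xrightarrow{\ \iota\ } G \xrightarrow{\ \pi\ } H \longrightarrow 1 \] of black box groups and all effective presentations of $N$ and $H$, with presentations $P_N=\langle Y\mid U\rangle$ and $P_H=\langle X\mid T\rangle$. Suppose that all codes of elements of $N$, $G$, $H$ and the written presentations $P_N$, $P_H$ have length at most $s$, and that all algorithms that come with $N,G,H,\iota,\pi$ and the two effective presentations run in (expected) time at most $p(s+l)$ on inputs of length $l$. Then, with these algorithms as subroutines, 1. $\mathtt{construct}$, on input $(P_N,P_H)$, runs in expected time at most $q(s)$, and its output always consists of a presentation $P_G=\langle Z\mid V\rangle$ and an auxiliary datum $a$; 2. for each possible output, $P_G$ together with the algorithms $g\mapsto\mathtt{log}(a,g)$ and $w\mapsto\mathtt{exp}(a,w)$ is an effective presentation of $G$, and these algorithms run in expected time at most $q(s+l)$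 on inputs of length $l$; 3. $|Z|\le|X|+|Y|$ and $|V|\le|U|+|T|+|X|\cdot|Y|$. -/

import Mathlib

open scoped ENNReal

namespace BlackBox

/-! ### Data and their length -/

/-- Binary trees, the strings of the machine model. A tree is read as a list of trees along its
right spine: `nil` is the empty list and `pair a b` is the list with head `a` and tail `b`. -/
inductive Data : Type
  | nil : Data
  | pair (a b : Data) : Data

namespace Data

/-- The length of a datum: the number of nodes, leaves included
(a tree with `n` nodes is written with `n` bits in Polish notation). -/
def size : Data → ℕ
  | nil => 1
  | pair a b => 1 + a.size + b.size

/-- The entries of a datum that is read as a list. -/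
def toList : Data → List Data
  | nil => []
  | pair a b => a :: b.toList

/-- A list of data as a datum. -/
def ofList : List Data → Data
  | [] => nil
  | a :: l => pair a (ofList l)

/-- A bit: `false` is `nil` and `true` is `pair nil nil`. -/
def ofBool : Bool → Data
  | false => nil
  | true => pair nil nil

/-- Unary encoding of a natural number (used only to name and to count generators). -/
def ofNat (n : ℕ) : Data := ofList (List.replicate n nil)

/-- Binary encoding of an integer: its sign and the binary digits of its absolute value,
least significant digit first. -/
def ofInt (z : ℤ) : Data :=
  pair (ofBool (decide (z < 0))) (ofList (z.natAbs.bits.map ofBool))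

end Data

/-! ### Algorithms as seen from outside -/

/-- The behaviour of a deterministic algorithm: output and running time on each input. -/
abbrev DetAlgo : Type := Data → Data × ℕ

/-- The time that a deterministic algorithm takes to run and to write its output. -/
def DetAlgo.time (A : DetAlgo) (x : Data) : ℕ := (A x).2 + (A x).1.size

/-- The behaviour of a probabilistic algorithm: for each input, the joint distribution of the
output and of the running time. -/
abbrev Algo : Type := Data → PMF (Data × ℕ)

/-- The expected time that a probabilistic algorithm takes to run and to write its output. -/
noncomputable def Algo.expectedTime (A : Algo) (x : Data) : ℝ≥0∞ :=
  ∑' o : Data × ℕ, A x o * ((o.2 + o.1.size : ℕ) : ℝ≥0∞)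

/-- A deterministic algorithm is a probabilistic one. -/
noncomputable def DetAlgo.toAlgo (A : DetAlgo) : Algo := fun x => PMF.pure (A x)

/-! ### Programs with subroutines -/

/-- Programs that may call subroutines with names in `O`. A program uses finitely many of the
registers `0, 1, 2, …`, each of which holds a datum. There is no instruction that flips a coin:
a program is random only through the subroutines that it calls. -/
inductive Prog (O : Type) : Type
  /-- Do nothing. -/
  | skip : Prog O
  /-- Run the first program, then the second. -/
  | seq (p q : Prog O) : Prog O
  /-- Write the empty list to register `x`. -/
  | clear (x : ℕ) : Prog O
  /-- Copy register `y` to register `x`. -/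
  | copy (x y : ℕ) : Prog O
  /-- Put the content of register `y` in front of the list in register `x`. -/
  | push (x y : ℕ) : Prog O
  /-- Remove the first entry of the list in register `y` and write it to register `x`. -/
  | pop (x y : ℕ) : Prog O
  /-- Run the first program if register `x` holds the empty list, and otherwise the second. -/
  | ifNil (x : ℕ) (p q : Prog O) : Prog O
  /-- For each entry of the list that is in register `y` when the loop is entered, in order:
  write it to register `x`, then run the program. -/
  | forEach (x y : ℕ) (p : Prog O) : Prog O
  /-- Call the subroutine `o` on the content of register `y`, write the answer to `x`. -/
  | call (o : O) (x y : ℕ) : Prog O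

/-- The contents of the registers. -/
abbrev Store : Type := ℕ → Data

/-- A loop over a list of data; entering a round costs `1` plus the size of the entry. -/
noncomputable def iterate (x : ℕ) (body : Store → PMF (Store × ℕ)) :
    List Data → Store → PMF (Store × ℕ)
  | [], s => PMF.pure (s, 0)
  | d :: l, s =>
      (body (Function.update s x d)).bind fun r =>
        (iterate x body l r.1).map fun r' => (r'.1, 1 + d.size + r.2 + r'.2)

/-- The run of a program from a store: the joint distribution of the final store and of the
running time. An instruction costs `1` plus the size of the datum that it moves, and a subroutine
call costs in addition the running time of the subroutine. -/
noncomputable def Prog.run {O : Type} (env : O → Algo) : Prog O → Store → PMF (Store × ℕ)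
  | .skip, s => PMF.pure (s, 0)
  | .seq p q, s =>
      (p.run env s).bind fun r => (q.run env r.1).map fun r' => (r'.1, r.2 + r'.2)
  | .clear x, s => PMF.pure (Function.update s x .nil, 1)
  | .copy x y, s => PMF.pure (Function.update s x (s y), 1 + (s y).size)
  | .push x y, s => PMF.pure (Function.update s x (.pair (s y) (s x)), 1 + (s y).size)
  | .pop x y, s =>
      match s y with
      | .nil => PMF.pure (Function.update s x .nil, 1)
      | .pair a b => PMF.pure (Function.update (Function.update s y b) x a, 1 + a.size)
  | .ifNil x p q, s =>
      match s x with
      | .nil => (p.run env s).map fun r => (r.1, 1 + r.2)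
      | .pair _ _ => (q.run env s).map fun r => (r.1, 1 + r.2)
  | .forEach x y p, s =>
      (iterate x (p.run env) (s y).toList s).map fun r => (r.1, 1 + r.2)
  | .call o x y, s =>
      (env o (s y)).map fun r =>
        (Function.update s x r.1, 1 + (s y).size + r.2 + r.1.size)

/-- The algorithm given by a program: the input is in register `0` at the start, all other
registers are empty, and the output is in register `0` at the end. -/
noncomputable def Prog.exec {O : Type} (env : O → Algo) (p : Prog O) : Algo := fun d =>
  (p.run env (Function.update (fun _ => Data.nil) 0 d)).map fun r => (r.1 0, r.2)

/-! ### Finite presentations -/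

/-- Words in the generators with index in `Fin n` and their inverses, with exponents. -/
abbrev Word (n : ℕ) : Type := List (Fin n × ℤ)

namespace Word

/-- The element of the free group that a word stands for. -/
def toFreeGroup {n : ℕ} (w : Word n) : FreeGroup (Fin n) :=
  (w.map fun l => FreeGroup.of l.1 ^ l.2).prod

/-- Words are written down with binary exponents. -/
def encode {n : ℕ} (w : Word n) : Data :=
  Data.ofList (w.map fun l => Data.pair (Data.ofNat l.1) (Data.ofInt l.2))

end Word

/-- A finite presentation: a number of generators and a list of relators. -/
structure Presentation : Type where
  /-- The number of generators. -/
  gens : ℕ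
  /-- The relators. -/
  rels : List (Word gens)

namespace Presentation

/-- The group given by a presentation. -/
abbrev Group (P : Presentation) : Type :=
  PresentedGroup {x : FreeGroup (Fin P.gens) | ∃ r ∈ P.rels, r.toFreeGroup = x}

/-- The class of a word in the group given by a presentation. -/
def classOf (P : Presentation) (w : Word P.gens) : P.Group := PresentedGroup.mk _ w.toFreeGroup

/-- A presentation is written down as the number of generators and the list of relators. -/
def encode (P : Presentation) : Data :=
  Data.pair (Data.ofNat P.gens) (Data.ofList (P.rels.map Word.encode))

end Presentation

/-! ### Black box groups, their maps and their effective presentations -/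

/-- The structure of a black box group on `G`: the elements are encoded by data of bounded length
(an element may have several codes), and there are algorithms for multiplication, inversion and the
test for equality. -/
structure BlackBoxGroup (G : Type*) [Group G] where
  /-- The element with the given code; `none` if the datum is not a code. -/
  decode : Data → Option G
  /-- The bound on the length of codes. -/
  maxLen : ℕ
  mul : DetAlgo
  inv : DetAlgo
  eq : DetAlgo
  exists_code : ∀ g : G, ∃ c, decode c = some g
  size_le : ∀ c g, decode c = some g → c.size ≤ maxLen
  mul_spec : ∀ a b g h, decode a = some g → decode b = some h →
    decode (mul (.pair a b)).1 = some (g * h)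
  inv_spec : ∀ a g, decode a = some g → decode (inv a).1 = some g⁻¹
  eq_spec_true : ∀ a b g h, decode a = some g → decode b = some h → g = h →
    (eq (.pair a b)).1 = Data.ofBool true
  eq_spec_false : ∀ a b g h, decode a = some g → decode b = some h → g ≠ h →
    (eq (.pair a b)).1 = Data.ofBool false

/-- On codes, the algorithms of the black box group take time at most `b l`, where `l` is the
length of their input. -/
def BlackBoxGroup.RunsIn {G : Type*} [Group G] (B : BlackBoxGroup G) (b : ℕ → ℕ) : Prop :=
  (∀ x y g h, B.decode x = some g → B.decode y = some h →
    B.mul.time (.pair x y) ≤ b (Data.pair x y).size ∧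
    B.eq.time (.pair x y) ≤ b (Data.pair x y).size) ∧
  (∀ x g, B.decode x = some g → B.inv.time x ≤ b x.size)

/-- What turns a homomorphism `f` into a map of black box groups: algorithms that evaluate `f` and
that find preimages of elements of its image. -/
structure BlackBoxMap {G H : Type*} [Group G] [Group H]
    (A : BlackBoxGroup G) (B : BlackBoxGroup H) (f : G →* H) where
  apply : DetAlgo
  preimage : DetAlgo
  apply_spec : ∀ c g, A.decode c = some g → B.decode (apply c).1 = some (f g)
  preimage_spec : ∀ c h, B.decode c = some h → h ∈ f.range →
    ∃ g, A.decode (preimage c).1 = some g ∧ f g = h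

/-- On codes of elements of the source (of the image), evaluation (search of a preimage) takes time
at most `b l`, where `l` is the length of the input. -/
def BlackBoxMap.RunsIn {G H : Type*} [Group G] [Group H] {A : BlackBoxGroup G}
    {B : BlackBoxGroup H} {f : G →* H} (F : BlackBoxMap A B f) (b : ℕ → ℕ) : Prop :=
  (∀ c g, A.decode c = some g → F.apply.time c ≤ b c.size) ∧
  (∀ c h, B.decode c = some h → h ∈ f.range → F.preimage.time c ≤ b c.size)

/-- An effective presentation of a black box group: a finite presentation, a probabilistic
algorithm `log` from (codes of) elements to words and a probabilistic algorithm `exp` from words to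
(codes of) elements, which induce inverse isomorphisms. -/
structure EffectivePresentation {G : Type*} [Group G] (B : BlackBoxGroup G) where
  pres : Presentation
  log : Algo
  exp : Algo
  correct : ∃ α : G ≃* pres.Group,
    (∀ c g, B.decode c = some g → ∀ o ∈ (log c).support,
      ∃ w : Word pres.gens, o.1 = w.encode ∧ pres.classOf w = α g) ∧
    (∀ w : Word pres.gens, ∀ o ∈ (exp w.encode).support,
      B.decode o.1 = some (α.symm (pres.classOf w)))

/-- On codes and on words, the algorithms of an effective presentation take expected time at most
`b l`, where `l` is the length of the input. -/
def EffectivePresentation.RunsIn {G : Type*} [Group G] {B : BlackBoxGroup G}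
    (E : EffectivePresentation B) (b : ℕ → ℕ) : Prop :=
  (∀ c g, B.decode c = some g → E.log.expectedTime c ≤ (b c.size : ℝ≥0∞)) ∧
  (∀ w : Word E.pres.gens, E.exp.expectedTime w.encode ≤ (b w.encode.size : ℝ≥0∞))

/-! ### Extensions -/

/-- An exact sequence `1 → N → G → H → 1` of black box groups together with effective presentations
of `N` and `H`. -/
structure Extension (N G H : Type*) [Group N] [Group G] [Group H] where
  boxN : BlackBoxGroup N
  boxG : BlackBoxGroup G
  boxH : BlackBoxGroup H
  ι : N →* G
  π : G →* H
  ι_injective : Function.Injective ι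
  exact : ι.range = π.ker
  π_surjective : Function.Surjective π
  mapι : BlackBoxMap boxN boxG ι
  mapπ : BlackBoxMap boxG boxH π
  presN : EffectivePresentation boxN
  presH : EffectivePresentation boxH

/-- The names of the algorithms that come with an extension. -/
inductive Subroutine : Type
  | mulN | invN | eqN
  | mulG | invG | eqG
  | mulH | invH | eqH
  | applyι | preimageι
  | applyπ | preimageπ
  | logN | expN
  | logH | expH

namespace Extension

variable {N G H : Type*} [Group N] [Group G] [Group H]

/-- The algorithms that come with an extension. -/
noncomputable def env (S : Extension N G H) : Subroutine → Algo
  | .mulN => S.boxN.mul.toAlgo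
  | .invN => S.boxN.inv.toAlgo
  | .eqN => S.boxN.eq.toAlgo
  | .mulG => S.boxG.mul.toAlgo
  | .invG => S.boxG.inv.toAlgo
  | .eqG => S.boxG.eq.toAlgo
  | .mulH => S.boxH.mul.toAlgo
  | .invH => S.boxH.inv.toAlgo
  | .eqH => S.boxH.eq.toAlgo
  | .applyι => S.mapι.apply.toAlgo
  | .preimageι => S.mapι.preimage.toAlgo
  | .applyπ => S.mapπ.apply.toAlgo
  | .preimageπ => S.mapπ.preimage.toAlgo
  | .logN => S.presN.log
  | .expN => S.presN.exp
  | .logH => S.presH.log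
  | .expH => S.presH.exp

/-- The two given presentations, written down. -/
def input (S : Extension N G H) : Data :=
  .pair S.presN.pres.encode S.presH.pres.encode

/-- The extension has size at most `s`: codes and the written presentations have length at
most `s`. -/
def SizeLE (S : Extension N G H) (s : ℕ) : Prop :=
  S.boxN.maxLen ≤ s ∧ S.boxG.maxLen ≤ s ∧ S.boxH.maxLen ≤ s ∧
  S.presN.pres.encode.size ≤ s ∧ S.presH.pres.encode.size ≤ s

/-- All algorithms that come with the extension take (expected) time at most `b l` on inputs of
length `l`. -/
def RunsIn (S : Extension N G H) (b : ℕ → ℕ) : Prop :=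
  S.boxN.RunsIn b ∧ S.boxG.RunsIn b ∧ S.boxH.RunsIn b ∧
  S.mapι.RunsIn b ∧ S.mapπ.RunsIn b ∧ S.presN.RunsIn b ∧ S.presH.RunsIn b

end Extension

end BlackBox

open BlackBox

/-!
An extension of `H = ⟨X | T⟩` by `N = ⟨Y | U⟩` is presented by the generators `Y`, lifts of the
generators `X`, the relators `U`, and, for every word `v` among the lifted relators `T` and the
conjugates `x y x⁻¹`, a relator `u v` where `u` is a word in `Y` for the inverse of the value
of `v`.
Let `P` be the group with this presentation. The subgroup of `P` generated by `Y` is a copy of `N`,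
since it is a quotient of `N` by the relators `U` and maps onto `N`. It is finite, because the
codes of elements of a black box group have bounded length, so an element that conjugates it into
itself normalizes it, and the conjugates by inverses of generators need no relators. Modulo this
normal subgroup, `P` is a quotient of `H` that maps onto `H`, so `P → G` is an isomorphism
(`exists_mulEquiv_of_extension`).

The words `u` and the logarithm in `G` are computed by the same routine
(`Extension.completeWord`): if `g` and the word `v` have the same image in `H`, evaluate `v` in `G`,
take the preimage in `N` of the quotient of `g` by this value, and put its logarithm in front
of `v`. For the logarithm of `g`, the word `v` is a lift of a logarithm of the image of `g`.
Words are evaluated by repeated squaring, in time linear in their length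
(`Extension.det_evalWord`).

The one delicate point is the running time. The given logarithms produce words of random length, of
which only the expectation is bounded: the expected square of the length may be infinite. All
that is done with such a word therefore has to be linear in its length; the coefficient
may be a polynomial in the size parameter. This is why words are only concatenated, and inverses are
taken of elements of `G`. The analysis (`Triple`) bounds the expected value of the running time so
far plus a potential, which is a linear function of the lengths of the random words in the
registers. Codes have bounded length, so the other computations are deterministic up to the
choice of codes (`Det`).
-/

namespace BlackBox

/-! ### Expectations -/

/-- The expectation of a nonnegative function under a discrete distribution. -/
noncomputable def expectation {α : Type*} (μ : PMF α) (g : α → ℝ≥0∞) : ℝ≥0∞ := ∑' a, μ a * g a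

section Expectation

variable {α β : Type*}

theorem expectation_pure (a : α) (g : α → ℝ≥0∞) : expectation (PMF.pure a) g = g a := by
  unfold expectation
  rw [tsum_eq_single a]
  · simp
  · intro b hb
    simp [PMF.pure_apply, hb]

theorem expectation_bind (μ : PMF α) (f : α → PMF β) (g : β → ℝ≥0∞) :
    expectation (μ.bind f) g = expectation μ fun a => expectation (f a) g := by
  unfold expectation
  simp only [PMF.bind_apply, ← ENNReal.tsum_mul_right, ← ENNReal.tsum_mul_left]
  rw [ENNReal.tsum_comm]
  simp only [mul_assoc]

theorem expectation_map (μ : PMF α) (f : α → β) (g : β → ℝ≥0∞) :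
    expectation (μ.map f) g = expectation μ fun a => g (f a) := by
  rw [← PMF.bind_pure_comp, expectation_bind]
  simp only [Function.comp, expectation_pure]

theorem expectation_mono {μ : PMF α} {f g : α → ℝ≥0∞} (h : ∀ a ∈ μ.support, f a ≤ g a) :
    expectation μ f ≤ expectation μ g := by
  refine ENNReal.tsum_le_tsum fun a => ?_
  by_cases ha : a ∈ μ.support
  · exact mul_le_mul_right (h a ha) _
  · rw [PMF.mem_support_iff, not_not] at ha
    simp [ha]

theorem expectation_add (μ : PMF α) (f g : α → ℝ≥0∞) :
    (expectation μ fun a => f a + g a) = expectation μ f + expectation μ g := by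
  simp only [expectation, mul_add, ENNReal.tsum_add]

theorem expectation_const (μ : PMF α) (c : ℝ≥0∞) : (expectation μ fun _ => c) = c := by
  rw [expectation, ENNReal.tsum_mul_right, PMF.tsum_coe, one_mul]

theorem expectation_const_mul (μ : PMF α) (c : ℝ≥0∞) (f : α → ℝ≥0∞) :
    (expectation μ fun a => c * f a) = c * expectation μ f := by
  simp only [expectation, ← ENNReal.tsum_mul_left]
  exact tsum_congr fun a => by ring

end Expectation

/-! ### Lists of data -/

namespace Data

/-- The first entry of a list, and `nil` for the empty list. -/
def head : Data → Data
  | nil => nil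
  | pair a _ => a

/-- The list without its first entry. -/
def tail : Data → Data
  | nil => nil
  | pair _ b => b

/-- The length of the first entry of a list, and `0` for the empty list. -/
def headSize : Data → ℕ
  | nil => 0
  | pair a _ => a.size

theorem one_le_size (d : Data) : 1 ≤ d.size := by
  cases d <;> simp only [size] <;> omega

theorem headSize_lt (d : Data) : d.headSize < d.size := by
  cases d <;> simp only [size, headSize] <;> omega

theorem toList_ofList (l : List Data) : (ofList l).toList = l := by
  induction l with
  | nil => rfl
  | cons d l ih => rw [ofList, toList, ih]

theorem size_ofList (l : List Data) : (ofList l).size = 1 + (l.map fun d => 1 + d.size).sum := by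
  induction l with
  | nil => rfl
  | cons d l ih => simp only [ofList, size, ih, List.map_cons, List.sum_cons]; omega

theorem ofList_toList (d : Data) : ofList d.toList = d := by
  induction d with
  | nil => rfl
  | pair a b _ ih => rw [toList, ofList, ih]

theorem size_ofList_append (l m : List Data) :
    (ofList (l ++ m)).size + 1 = (ofList l).size + (ofList m).size := by
  simp only [size_ofList, List.map_append, List.sum_append]
  omega

theorem size_ofNat (n : ℕ) : (ofNat n).size = 2 * n + 1 := by
  simp only [ofNat, size_ofList, List.map_replicate, List.sum_replicate, size, smul_eq_mul]
  omega

theorem ofNat_succ (n : ℕ) : ofNat (n + 1) = pair nil (ofNat n) := rfl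

end Data

/-! ### Programs without randomness -/

section Calculus

variable {O : Type} {env : O → Algo}

/-- The run of the program is deterministic, and its final store and its running time satisfy
the postcondition. -/
def Det (env : O → Algo) (p : Prog O) (s : Store) (Q : Store → ℕ → Prop) : Prop :=
  ∃ s' t, p.run env s = PMF.pure (s', t) ∧ Q s' t

theorem Det.mono {p : Prog O} {s : Store} {Q R : Store → ℕ → Prop} (h : Det env p s Q)
    (hQ : ∀ s' t, Q s' t → R s' t) : Det env p s R := by
  obtain ⟨s', t, h, h'⟩ := h
  exact ⟨s', t, h, hQ _ _ h'⟩

theorem det_of_run {p : Prog O} {s s' : Store} {t : ℕ} {Q : Store → ℕ → Prop}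
    (h : p.run env s = PMF.pure (s', t)) : Det env p s Q ↔ Q s' t := by
  constructor
  · rintro ⟨s'', t', h', hQ⟩
    have : ((s', t) : Store × ℕ) = (s'', t') := by
      have hm : (s', t) ∈ (PMF.pure (s'', t') : PMF (Store × ℕ)).support := by
        rw [← h', h]; simp
      simpa using hm
    cases this
    exact hQ
  · exact fun hQ => ⟨s', t, h, hQ⟩

theorem det_skip {s : Store} {Q : Store → ℕ → Prop} : Det env .skip s Q ↔ Q s 0 :=
  det_of_run rfl

theorem det_clear {x : ℕ} {s : Store} {Q : Store → ℕ → Prop} :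
    Det env (.clear x) s Q ↔ Q (Function.update s x .nil) 1 :=
  det_of_run rfl

theorem det_copy {x y : ℕ} {s : Store} {Q : Store → ℕ → Prop} :
    Det env (.copy x y) s Q ↔ Q (Function.update s x (s y)) (1 + (s y).size) :=
  det_of_run rfl

theorem det_push {x y : ℕ} {s : Store} {Q : Store → ℕ → Prop} :
    Det env (.push x y) s Q ↔
      Q (Function.update s x (.pair (s y) (s x))) (1 + (s y).size) :=
  det_of_run rfl

theorem det_pop {x y : ℕ} {s : Store} {Q : Store → ℕ → Prop} :
    Det env (.pop x y) s Q ↔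
      Q (Function.update (Function.update s y (s y).tail) x (s y).head) (1 + (s y).headSize) := by
  refine det_of_run ?_
  cases h : s y with
  | nil =>
    rw [Data.tail, ← h, Function.update_eq_self]
    simp only [Prog.run, h, Data.head, Data.headSize, Nat.add_zero]
  | pair a b => simp only [Prog.run, h, Data.head, Data.tail, Data.headSize]

theorem det_call {o : O} {A : DetAlgo} (ho : env o = A.toAlgo) {x y : ℕ} {s : Store}
    {Q : Store → ℕ → Prop} :
    Det env (.call o x y) s Q ↔
      Q (Function.update s x (A (s y)).1) (1 + (s y).size + A.time (s y)) :=
  det_of_run (by simp [Prog.run, ho, DetAlgo.toAlgo, PMF.pure_map, DetAlgo.time, add_assoc])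

theorem det_seq {p q : Prog O} {s : Store} {Q : Store → ℕ → Prop}
    (h : Det env p s fun s' t => Det env q s' fun s'' t' => Q s'' (t + t')) :
    Det env (.seq p q) s Q := by
  obtain ⟨s', t, h, s'', t', h', hQ⟩ := h
  exact ⟨s'', t + t', by simp [Prog.run, h, h', PMF.pure_bind, PMF.pure_map], hQ⟩

theorem det_ifNil {x : ℕ} {p q : Prog O} {s : Store} {Q : Store → ℕ → Prop}
    (hp : s x = .nil → Det env p s fun s' t => Q s' (1 + t))
    (hq : s x ≠ .nil → Det env q s fun s' t => Q s' (1 + t)) :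
    Det env (.ifNil x p q) s Q := by
  cases hx : s x with
  | nil =>
    obtain ⟨s', t, h, hQ⟩ := hp hx
    exact ⟨s', 1 + t, by simp [Prog.run, hx, h, PMF.pure_map], hQ⟩
  | pair a b =>
    obtain ⟨s', t, h, hQ⟩ := hq (by simp [hx])
    exact ⟨s', 1 + t, by simp [Prog.run, hx, h, PMF.pure_map], hQ⟩

/-- The loop rule for a loop over `l`, with an invariant `I r s` on the part `r` of the list
that is still to come. The body may cost `B` per unit of the size of the entry. -/
theorem det_forEach {x y : ℕ} {p : Prog O} {s : Store} (I : List Data → Store → Prop) (B : ℕ)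
    {Q : Store → ℕ → Prop} (h0 : I (s y).toList s)
    (hstep : ∀ d l s, I (d :: l) s → Det env p (Function.update s x d)
      fun s' t => I l s' ∧ t ≤ B * (1 + d.size))
    (hQ : ∀ s' t, I [] s' → t ≤ (1 + B) * (s y).size → Q s' t) :
    Det env (.forEach x y p) s Q := by
  have key : ∀ (l : List Data) (s : Store), I l s → ∃ s' t,
      iterate x (p.run env) l s = PMF.pure (s', t) ∧ I [] s' ∧
        t ≤ (1 + B) * (l.map fun e => 1 + e.size).sum := by
    intro l
    induction l with
    | nil => exact fun s hs => ⟨s, 0, rfl, hs, by simp⟩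
    | cons d l ih =>
      intro s hs
      obtain ⟨s₁, t₁, h₁, hI, ht₁⟩ := hstep d l s hs
      obtain ⟨s₂, t₂, h₂, hI₂, ht₂⟩ := ih s₁ hI
      refine ⟨s₂, 1 + d.size + t₁ + t₂, by simp [iterate, h₁, h₂, PMF.pure_bind, PMF.pure_map],
        hI₂, ?_⟩
      simp only [List.map_cons, List.sum_cons]
      rw [mul_add]
      nlinarith
  obtain ⟨s', t, h, hI, ht⟩ := key _ _ h0
  refine ⟨s', 1 + t, by simp [Prog.run, h, PMF.pure_map], hQ _ _ hI ?_⟩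
  have hsize := Data.size_ofList (s y).toList
  rw [Data.ofList_toList] at hsize
  rw [hsize, mul_add]
  omega

/-! ### Programs with random subroutines -/

/-- All possible final stores of the program satisfy `Q`, and the expected value of the running
time plus the potential `Φ` of the final store is at most `c`. -/
def Triple (env : O → Algo) (p : Prog O) (s : Store) (Q : Store → Prop) (Φ : Store → ℝ≥0∞)
    (c : ℝ≥0∞) : Prop :=
  (∀ r ∈ (p.run env s).support, Q r.1) ∧
    expectation (p.run env s) (fun r => r.2 + Φ r.1) ≤ c

theorem Triple.mono {p : Prog O} {s : Store} {Q : Store → Prop} {Φ : Store → ℝ≥0∞}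
    {c : ℝ≥0∞} (h : Triple env p s Q Φ c) {Q' : Store → Prop} {Φ' : Store → ℝ≥0∞} {c' : ℝ≥0∞}
    (hQ : ∀ s', Q s' → Q' s' ∧ Φ' s' ≤ Φ s') (hc : c ≤ c') : Triple env p s Q' Φ' c' :=
  ⟨fun r hr => (hQ _ (h.1 r hr)).1, (expectation_mono fun r hr =>
    add_le_add le_rfl (hQ _ (h.1 r hr)).2).trans (h.2.trans hc)⟩

theorem Triple.add_const {p : Prog O} {s : Store} {Q : Store → Prop} {Φ : Store → ℝ≥0∞}
    {c : ℝ≥0∞} (h : Triple env p s Q Φ c) (a : ℝ≥0∞) :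
    Triple env p s Q (fun s' => Φ s' + a) (c + a) := by
  refine ⟨h.1, ?_⟩
  simp only [← add_assoc]
  rw [expectation_add, expectation_const]
  gcongr
  exact h.2

theorem Det.triple {p : Prog O} {s : Store} {Q : Store → ℕ → Prop} (h : Det env p s Q)
    {R : Store → Prop} {Φ : Store → ℝ≥0∞} {c : ℝ≥0∞}
    (hQ : ∀ s' t, Q s' t → R s' ∧ t + Φ s' ≤ c) : Triple env p s R Φ c := by
  obtain ⟨s', t, h, h'⟩ := h
  refine ⟨fun r hr => ?_, ?_⟩
  · rw [h] at hr
    simp only [PMF.support_pure, Set.mem_singleton_iff] at hr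
    rw [hr]
    exact (hQ _ _ h').1
  · rw [h, expectation_pure]
    exact (hQ _ _ h').2

theorem triple_seq {p q : Prog O} {s : Store} {Q R : Store → Prop} {Φ Ψ : Store → ℝ≥0∞}
    {c : ℝ≥0∞} (hp : Triple env p s R Ψ c) (hq : ∀ s', R s' → Triple env q s' Q Φ (Ψ s')) :
    Triple env (.seq p q) s Q Φ c := by
  refine ⟨fun r hr => ?_, ?_⟩
  · simp only [Prog.run, PMF.mem_support_bind_iff, PMF.mem_support_map_iff] at hr
    obtain ⟨r₁, hr₁, r₂, hr₂, rfl⟩ := hr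
    have := (hq _ (hp.1 _ hr₁)).1 _ hr₂
    exact this
  · refine le_trans ?_ hp.2
    simp only [Prog.run, expectation_bind, expectation_map]
    refine expectation_mono fun r hr => ?_
    refine le_trans ?_ (add_le_add le_rfl (hq _ (hp.1 _ hr)).2)
    simp only [Nat.cast_add, add_assoc]
    rw [expectation_add, expectation_const]

/-- A deterministic program followed by a random one. -/
theorem Det.triple_seq {p q : Prog O} {s : Store} {R : Store → ℕ → Prop} (hp : Det env p s R)
    {Q : Store → Prop} {Φ : Store → ℝ≥0∞} {c : ℝ≥0∞} (t₀ : ℕ) {c' : ℝ≥0∞}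
    (ht : ∀ s' t, R s' t → t ≤ t₀)
    (hq : ∀ s' t, R s' t → Triple env q s' Q Φ c') (hc : t₀ + c' ≤ c) :
    Triple env (.seq p q) s Q Φ c := by
  refine BlackBox.triple_seq (R := fun s' => ∃ t, R s' t) (Ψ := fun _ => c')
    (hp.triple fun s' t h => ⟨⟨t, h⟩, le_trans ?_ hc⟩) ?_
  · exact add_le_add (by exact_mod_cast ht _ _ h) le_rfl
  · rintro s' ⟨t, h⟩
    exact hq s' t h

/-- A call whose answer has the property `D`; the potential afterwards may grow with slope `K` in
the size of the answer. -/
theorem triple_call {o : O} {x y : ℕ} {s : Store} {D : Data → Prop} {b K a : ℝ≥0∞}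
    (hD : ∀ r ∈ (env o (s y)).support, D r.1) (hb : (env o).expectedTime (s y) ≤ b)
    {Q : Store → Prop} {Φ : Store → ℝ≥0∞} {c : ℝ≥0∞}
    (hQ : ∀ d, D d → Q (Function.update s x d))
    (hΦ : ∀ d, D d → Φ (Function.update s x d) ≤ a + K * d.size)
    (hc : 1 + (s y).size + a + (1 + K) * b ≤ c) :
    Triple env (.call o x y) s Q Φ c := by
  refine ⟨fun r hr => ?_, le_trans ?_ hc⟩
  · simp only [Prog.run, PMF.mem_support_map_iff] at hr
    obtain ⟨r₁, hr₁, rfl⟩ := hr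
    exact hQ _ (hD _ hr₁)
  · simp only [Prog.run, expectation_map]
    calc _ ≤ expectation (env o (s y)) fun r => (1 + (s y).size + a) +
            (1 + K) * ((r.2 + r.1.size : ℕ) : ℝ≥0∞) := by
          refine expectation_mono fun r hr => ?_
          refine (add_le_add le_rfl (hΦ _ (hD _ hr))).trans ?_
          push_cast
          calc _ = 1 + ((s y).size : ℝ≥0∞) + a + (r.2 + r.1.size + K * r.1.size) := by ring
            _ ≤ 1 + ((s y).size : ℝ≥0∞) + a + (r.2 + r.1.size + K * r.1.size + K * r.2) := by
                exact add_le_add le_rfl le_self_add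
            _ = _ := by ring
      _ ≤ _ := by
          rw [expectation_add, expectation_const, expectation_const_mul]
          gcongr
          exact hb

/-- The loop rule for a random body: `I r s` is the invariant and `Ψ r s` the potential when the
part `r` of the list is still to come. -/
theorem triple_forEach {x y : ℕ} {p : Prog O} {s : Store} (I : List Data → Store → Prop)
    (Ψ : List Data → Store → ℝ≥0∞) (h0 : I (s y).toList s)
    (hstep : ∀ d l s, I (d :: l) s → ∃ c, Triple env p (Function.update s x d) (I l) (Ψ l) c ∧
      1 + d.size + c ≤ Ψ (d :: l) s)
    {c : ℝ≥0∞} (hc : 1 + Ψ (s y).toList s ≤ c) :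
    Triple env (.forEach x y p) s (I []) (Ψ []) c := by
  have key : ∀ (l : List Data) (s : Store), I l s →
      (∀ r ∈ (iterate x (p.run env) l s).support, I [] r.1) ∧
      expectation (iterate x (p.run env) l s) (fun r => r.2 + Ψ [] r.1) ≤ Ψ l s := by
    intro l
    induction l with
    | nil =>
      intro s hs
      simp only [iterate, expectation_pure]
      refine ⟨fun r hr => ?_, by simp⟩
      simp only [PMF.support_pure, Set.mem_singleton_iff] at hr
      rw [hr]; exact hs
    | cons d l ih =>
      intro s hs
      obtain ⟨c, hT, hc⟩ := hstep d l s hs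
      refine ⟨fun r hr => ?_, le_trans ?_ hc⟩
      · simp only [iterate, PMF.mem_support_bind_iff, PMF.mem_support_map_iff] at hr
        obtain ⟨r₁, hr₁, r₂, hr₂, rfl⟩ := hr
        have := (ih _ (hT.1 _ hr₁)).1 _ hr₂
        exact this
      · simp only [iterate, expectation_bind, expectation_map]
        calc _ ≤ expectation (p.run env (Function.update s x d)) fun r =>
                (1 + d.size : ℝ≥0∞) + (r.2 + Ψ l r.1) := by
              refine expectation_mono fun r hr => ?_
              have := (ih _ (hT.1 _ hr)).2
              simp only [Nat.cast_add, Nat.cast_one, add_assoc]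
              simp only [expectation_add, expectation_const] at this ⊢
              gcongr
          _ ≤ _ := by
              rw [expectation_add, expectation_const]
              gcongr
              exact hT.2
  refine ⟨fun r hr => ?_, le_trans ?_ hc⟩
  · simp only [Prog.run, PMF.mem_support_map_iff] at hr
    obtain ⟨r₁, hr₁, rfl⟩ := hr
    have := (key _ _ h0).1 _ hr₁
    exact this
  · simp only [Prog.run, expectation_map, Nat.cast_add, Nat.cast_one, add_assoc]
    rw [expectation_add, expectation_const]
    gcongr
    exact (key _ _ h0).2

/-- The loop rule for a loop that counts to `n`, with an invariant `I i s` after `i` rounds. -/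
theorem det_forEachNat {x y n : ℕ} {p : Prog O} {s : Store} (hy : s y = Data.ofNat n)
    (I : ℕ → Store → Prop) (B : ℕ) {Q : Store → ℕ → Prop} (h0 : I 0 s)
    (hstep : ∀ i s, i < n → I i s → Det env p (Function.update s x .nil)
      fun s' t => I (i + 1) s' ∧ t ≤ B)
    (hQ : ∀ s' t, I n s' → t ≤ (1 + B) * (2 * n + 1) → Q s' t) :
    Det env (.forEach x y p) s Q := by
  refine det_forEach (fun l s' => ∃ i, i + l.length = n ∧ (∀ d ∈ l, d = .nil) ∧ I i s') B ?_ ?_ ?_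
  · exact ⟨0, by simp [hy, Data.ofNat, Data.toList_ofList],
      by simp [hy, Data.ofNat, Data.toList_ofList], h0⟩
  · rintro d l s' ⟨i, hi, hl, hI⟩
    rw [List.length_cons] at hi
    rw [hl d (by simp)]
    refine (hstep i s' (by omega) hI).mono fun s'' t h => ⟨⟨i + 1, by omega,
      fun d hd => hl d (by simp [hd]), h.1⟩, h.2.trans (Nat.le_mul_of_pos_right _ (by omega))⟩
  · rintro s' t ⟨i, hi, -, hI⟩ ht
    rw [List.length_nil, Nat.add_zero] at hi
    rw [hy, Data.size_ofNat] at ht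
    exact hQ _ _ (hi ▸ hI) ht

theorem triple_forEachNat {x y n : ℕ} {p : Prog O} {s : Store} (hy : s y = Data.ofNat n)
    (I : ℕ → Store → Prop) (B : ℕ) (h0 : I 0 s)
    (hstep : ∀ i s, i < n → I i s → Triple env p (Function.update s x .nil)
      (I (i + 1)) (fun _ => 0) B) :
    Triple env (.forEach x y p) s (I n) (fun _ => 0) (1 + n * (2 + B) : ℕ) := by
  refine (triple_forEach (fun l s' => ∃ i, i + l.length = n ∧ (∀ d ∈ l, d = .nil) ∧ I i s')
    (fun l _ => (l.length * (2 + B) : ℕ)) (c := (1 + n * (2 + B) : ℕ)) ?_ ?_ ?_).mono ?_ le_rfl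
  · exact ⟨0, by simp [hy, Data.ofNat, Data.toList_ofList],
      by simp [hy, Data.ofNat, Data.toList_ofList], h0⟩
  · rintro d l s' ⟨i, hi, hl, hI⟩
    rw [List.length_cons] at hi
    rw [hl d (by simp)]
    refine ⟨(B : ℝ≥0∞) + (l.length * (2 + B) : ℕ),
      ((hstep i s' (by omega) hI).add_const ((l.length * (2 + B) : ℕ) : ℝ≥0∞)).mono
        (fun s'' h => ⟨⟨i + 1, by omega, fun d hd => hl d (by simp [hd]), h⟩, by simp⟩) le_rfl, ?_⟩
    have : 1 + Data.nil.size + (B + l.length * (2 + B)) ≤ (d :: l).length * (2 + B) := by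
      simp only [Data.size, List.length_cons, Nat.succ_mul]; omega
    exact_mod_cast this
  · simp [hy, Data.ofNat, Data.toList_ofList]
  · rintro s' ⟨i, hi, -, hI⟩
    rw [List.length_nil, Nat.add_zero] at hi
    exact ⟨hi ▸ hI, by simp⟩

/-- A triple for the initial store, with the length of the output as potential, bounds the expected
time, which includes the time for writing the output. -/
theorem Triple.exec {p : Prog O} {d : Data} {Q : Store → Prop} {c : ℝ≥0∞}
    (h : Triple env p (Function.update (fun _ => Data.nil) 0 d) Q (fun s => (s 0).size) c) :
    (∀ o ∈ (p.exec env d).support, ∃ s, Q s ∧ o.1 = s 0) ∧ (p.exec env).expectedTime d ≤ c := by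
  refine ⟨fun o ho => ?_, ?_⟩
  · simp only [Prog.exec, PMF.mem_support_map_iff] at ho
    obtain ⟨r, hr, rfl⟩ := ho
    exact ⟨r.1, h.1 r hr, rfl⟩
  · refine le_trans (le_of_eq ?_) h.2
    change expectation (p.exec env d) (fun o => ((o.2 + o.1.size : ℕ) : ℝ≥0∞)) = _
    simp only [Prog.exec, expectation_map, Nat.cast_add]

end Calculus

/-! ### Words and presentations of extensions -/

namespace Word

variable {n m : ℕ} {G : Type*} [Group G]

/-- Renaming of the generators in a word. -/
def mapGens (f : Fin n → Fin m) (w : Word n) : Word m := w.map fun l => (f l.1, l.2)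

/-- The value of a word when the generators take the values `γ`. -/
def eval (γ : Fin n → G) (w : Word n) : G := FreeGroup.lift γ w.toFreeGroup

theorem eval_nil (γ : Fin n → G) : eval γ [] = 1 := by simp [eval, toFreeGroup]

theorem eval_cons (γ : Fin n → G) (l : Fin n × ℤ) (w : Word n) :
    eval γ (l :: w) = γ l.1 ^ l.2 * eval γ w := by
  simp [eval, toFreeGroup]

theorem eval_append (γ : Fin n → G) (v w : Word n) :
    eval γ (v ++ w) = eval γ v * eval γ w := by
  simp [eval, toFreeGroup]

theorem eval_mapGens (f : Fin n → Fin m) (γ : Fin m → G) (w : Word n) :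
    eval γ (mapGens f w) = eval (fun i => γ (f i)) w := by
  induction w with
  | nil => simp [mapGens, eval_nil]
  | cons l w ih =>
    have : mapGens f (l :: w) = (f l.1, l.2) :: mapGens f w := rfl
    rw [this, eval_cons, eval_cons, ih]

theorem eval_mem {γ : Fin n → G} {S : Subgroup G} (h : ∀ i, γ i ∈ S) (w : Word n) :
    eval γ w ∈ S := by
  induction w with
  | nil => rw [eval_nil]; exact one_mem _
  | cons l w ih => rw [eval_cons]; exact mul_mem (zpow_mem (h _) _) ih

theorem toFreeGroup_singleton (i : Fin n) : toFreeGroup [(i, 1)] = FreeGroup.of i := by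
  simp [toFreeGroup]

end Word

namespace Presentation

/-- A homomorphism on a presented group evaluates words on the images of the generators. -/
theorem map_classOf {P : Presentation} {K : Type*} [_root_.Group K] (f : P.Group →* K)
    (w : Word P.gens) : f (P.classOf w) = w.eval fun i => f (P.classOf [(i, 1)]) := by
  have : f.comp (PresentedGroup.mk _) =
      FreeGroup.lift (fun i => f (P.classOf [(i, 1)])) := by
    ext i
    rw [FreeGroup.lift_apply_of, classOf, Word.toFreeGroup_singleton]
    rfl
  exact DFunLike.congr_fun this w.toFreeGroup

theorem classOf_eq_one {P : Presentation} {r : Word P.gens} (hr : r ∈ P.rels) :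
    P.classOf r = 1 :=
  PresentedGroup.one_of_mem ⟨r, hr, rfl⟩

theorem classOf_eq_eval (P : Presentation) (w : Word P.gens) :
    P.classOf w = w.eval fun i => P.classOf [(i, 1)] :=
  map_classOf (MonoidHom.id P.Group) w

theorem classOf_append (P : Presentation) (v w : Word P.gens) :
    P.classOf (v ++ w) = P.classOf v * P.classOf w := by
  rw [classOf_eq_eval, Word.eval_append, ← classOf_eq_eval, ← classOf_eq_eval]

/-- The homomorphism from a presented group that is given by values of the generators which
satisfy the relators. -/
def liftHom {P : Presentation} {K : Type*} [_root_.Group K] (γ : Fin P.gens → K)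
    (h : ∀ r ∈ P.rels, r.eval γ = 1) : P.Group →* K :=
  PresentedGroup.toGroup (f := γ) (by rintro _ ⟨r, hr, rfl⟩; exact h r hr)

theorem liftHom_classOf {P : Presentation} {K : Type*} [_root_.Group K] (γ : Fin P.gens → K)
    (h : ∀ r ∈ P.rels, r.eval γ = 1) (w : Word P.gens) :
    liftHom γ h (P.classOf w) = w.eval γ := by
  rw [map_classOf]
  congr 1
  funext i
  rw [classOf, Word.toFreeGroup_singleton]
  exact FreeGroup.lift_apply_of

theorem classOf_surjective (P : Presentation) : Function.Surjective P.classOf := by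
  have hw : ∀ x : FreeGroup (Fin P.gens), ∃ w : Word P.gens, w.toFreeGroup = x := by
    intro x
    induction x using FreeGroup.induction_on with
    | C1 => exact ⟨[], rfl⟩
    | of i => exact ⟨[(i, 1)], by simp [Word.toFreeGroup]⟩
    | inv_of i _ => exact ⟨[(i, -1)], by simp [Word.toFreeGroup]⟩
    | mul x y hx hy =>
      obtain ⟨v, rfl⟩ := hx
      obtain ⟨w, rfl⟩ := hy
      exact ⟨v ++ w, by simp [Word.toFreeGroup]⟩
  intro k
  obtain ⟨x, rfl⟩ := PresentedGroup.mk_surjective _ k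
  obtain ⟨w, rfl⟩ := hw x
  exact ⟨w, rfl⟩

end Presentation

/-- An element that conjugates a finite subgroup into itself normalizes it. -/
theorem mem_normalizer_of_conj_range {A K : Type*} [Group A] [Group K] [Finite A] (φ : A →* K)
    (k : K) (h : ∀ a, k * φ a * k⁻¹ ∈ φ.range) : k ∈ Subgroup.normalizer (φ.range : Set K) := by
  have : Finite φ.range := Finite.of_surjective _ φ.rangeRestrict_surjective
  -- Conjugation by `k` is an injective self-map of a finite set, so it is onto.
  let c : φ.range → φ.range := fun x => ⟨k * x * k⁻¹, by
    obtain ⟨x, a, rfl⟩ := x; exact h a⟩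
  have hc : Function.Injective c := by
    intro x y hxy
    have := congrArg Subtype.val hxy
    simpa [c] using this
  have hs := Finite.surjective_of_injective hc
  rw [Subgroup.mem_normalizer_iff]
  intro x
  constructor
  · rintro ⟨a, rfl⟩
    exact h a
  · intro hx
    obtain ⟨y, hy⟩ := hs ⟨_, hx⟩
    have := congrArg Subtype.val hy
    simp only [c, mul_left_inj, mul_right_inj] at this
    rw [← this]
    exact y.2

/-- The presentation of an extension. The generators are those of the normal subgroup, followed by
lifts of those of the quotient; every relator of the quotient and every conjugate of a generator of
the subgroup is equated with some word in the generators of the subgroup. The relators for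
conjugation by inverses are not needed since the normal subgroup is finite. -/
theorem exists_mulEquiv_of_extension {N G H : Type*} [Group N] [Group G] [Group H] [Finite N]
    {ι : N →* G} {π : G →* H} (hι : Function.Injective ι) (hex : ι.range = π.ker)
    {PN PH : Presentation} (αN : N ≃* PN.Group)
    (αH : H ≃* PH.Group) (γ : Fin (PN.gens + PH.gens) → G)
    (hY : ∀ j, γ (Fin.castAdd _ j) = ι (αN.symm (PN.classOf [(j, 1)])))
    (hX : ∀ i, π (γ (Fin.natAdd _ i)) = αH.symm (PH.classOf [(i, 1)]))
    (rels : List (Word (PN.gens + PH.gens)))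
    (hrel : ∀ r ∈ rels, r.eval γ = 1)
    (hU : ∀ u ∈ PN.rels, u.mapGens (Fin.castAdd _) ∈ rels)
    (hT : ∀ t ∈ PH.rels, ∃ u : Word PN.gens,
      u.mapGens (Fin.castAdd _) ++ t.mapGens (Fin.natAdd _) ∈ rels)
    (hC : ∀ i j, ∃ u : Word PN.gens, u.mapGens (Fin.castAdd _) ++
      [(Fin.natAdd _ i, 1), (Fin.castAdd _ j, 1), (Fin.natAdd _ i, -1)] ∈ rels) :
    ∃ α : G ≃* (Presentation.mk (PN.gens + PH.gens) rels).Group, ∀ w,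
      α.symm ((Presentation.mk (PN.gens + PH.gens) rels).classOf w) = w.eval γ := by
  set P := Presentation.mk (PN.gens + PH.gens) rels with hP
  have : Finite PN.Group := Finite.of_equiv _ αN.toEquiv
  let ψ : P.Group →* G := Presentation.liftHom (P := P) γ hrel
  have hψ : ∀ w, ψ (P.classOf w) = w.eval γ := Presentation.liftHom_classOf (P := P) γ hrel
  let z : Fin (PN.gens + PH.gens) → P.Group := fun i => P.classOf [(i, 1)]
  have hz : ∀ w : Word (PN.gens + PH.gens), P.classOf w = w.eval z := P.classOf_eq_eval
  -- The subgroup generated by the generators of the normal subgroup is a copy of that subgroup.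
  let φ : PN.Group →* P.Group := Presentation.liftHom (fun j => z (Fin.castAdd _ j)) (by
    intro u hu
    rw [← Word.eval_mapGens, ← hz]
    exact Presentation.classOf_eq_one (P := P) (hU u hu))
  have hφ : ∀ u, φ (PN.classOf u) = P.classOf (u.mapGens (Fin.castAdd _)) := by
    intro u
    rw [hz, Word.eval_mapGens]
    exact Presentation.liftHom_classOf _ _ u
  have hψφ : ∀ a, ψ (φ a) = ι (αN.symm a) := by
    intro a
    obtain ⟨u, rfl⟩ := PN.classOf_surjective a
    rw [hφ, hψ, Word.eval_mapGens]
    have := Presentation.map_classOf (ι.comp αN.symm.toMonoidHom) u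
    simp only [MonoidHom.comp_apply, MulEquiv.coe_toMonoidHom] at this
    rw [this]
    congr 1
    funext j
    exact hY j
  have hconj : ∀ i j, z (Fin.natAdd _ i) * φ (PN.classOf [(j, 1)]) * (z (Fin.natAdd _ i))⁻¹ ∈
      φ.range := by
    intro i j
    obtain ⟨u, hu⟩ := hC i j
    have := Presentation.classOf_eq_one (P := P) hu
    rw [hz, Word.eval_append, ← hz (Word.mapGens _ u), ← hφ] at this
    simp only [Word.eval_cons, Word.eval_nil, zpow_one, mul_one, zpow_neg] at this
    rw [hφ, hz]
    refine ⟨(PN.classOf u)⁻¹, ?_⟩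
    rw [map_inv, inv_eq_iff_mul_eq_one.2]
    simpa [Word.mapGens, Word.eval_cons, Word.eval_nil, mul_assoc] using this
  have hnorm : φ.range.Normal := by
    rw [← Subgroup.normalizer_eq_top_iff, eq_top_iff]
    rintro k -
    obtain ⟨w, rfl⟩ := P.classOf_surjective k
    have hgen : ∀ i, z i ∈ Subgroup.normalizer (φ.range : Set P.Group) := by
      intro i
      induction i using Fin.addCases with
      | left j =>
        refine Subgroup.le_normalizer ⟨PN.classOf [(j, 1)], ?_⟩
        rw [hφ]; rfl
      | right i =>
        refine mem_normalizer_of_conj_range φ _ fun a => ?_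
        obtain ⟨u, rfl⟩ := PN.classOf_surjective a
        have hmem : ∀ u : Word PN.gens,
            MulAut.conj (z (Fin.natAdd PN.gens i)) (φ (PN.classOf u)) ∈ φ.range := by
          intro u
          induction u with
          | nil =>
            have : PN.classOf ([] : Word PN.gens) = 1 := by
              rw [PN.classOf_eq_eval, Word.eval_nil]
            rw [this, map_one, map_one]
            exact one_mem _
          | cons l u ih =>
            rw [PN.classOf_eq_eval, Word.eval_cons, ← PN.classOf_eq_eval, map_mul, map_mul,
              map_zpow, map_zpow]
            exact mul_mem (zpow_mem (hconj i l.1) _) ih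
        exact hmem u
    rw [hz]
    exact Word.eval_mem hgen w
  -- Modulo this subgroup, the presented group is a quotient of the given quotient group.
  let θ : PH.Group →* P.Group ⧸ φ.range :=
    Presentation.liftHom (fun i => QuotientGroup.mk' φ.range (z (Fin.natAdd _ i))) (by
      intro t ht
      obtain ⟨u, hu⟩ := hT t ht
      have h1 := Presentation.classOf_eq_one (P := P) hu
      rw [Presentation.classOf_append, ← hφ] at h1
      have h2 := congrArg (QuotientGroup.mk' φ.range) h1
      rw [map_mul, map_one, show QuotientGroup.mk' φ.range (φ (PN.classOf u)) = 1 from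
          (QuotientGroup.eq_one_iff _).2 ⟨_, rfl⟩, one_mul, Presentation.map_classOf,
        Word.eval_mapGens] at h2
      exact h2)
  have hθ : ∀ w, θ (PH.classOf w) =
      w.eval fun i => QuotientGroup.mk' φ.range (z (Fin.natAdd _ i)) :=
    Presentation.liftHom_classOf _ _
  have hθsurj : ∀ k : P.Group, ∃ h, θ h = QuotientGroup.mk' φ.range k := by
    intro k
    obtain ⟨w, rfl⟩ := P.classOf_surjective k
    rw [Presentation.map_classOf]
    change _ ∈ θ.range
    have hgen : ∀ i, QuotientGroup.mk' φ.range (P.classOf [(i, 1)]) ∈ θ.range := by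
      intro i
      induction i using Fin.addCases with
      | left j =>
        rw [show QuotientGroup.mk' φ.range (P.classOf [(Fin.castAdd _ j, 1)]) = 1 from
          (QuotientGroup.eq_one_iff _).2 ⟨PN.classOf [(j, 1)], by rw [hφ]; rfl⟩]
        exact one_mem _
      | right i => exact ⟨PH.classOf [(i, 1)], by simp [hθ, Word.eval_cons, Word.eval_nil, z]⟩
    exact Word.eval_mem hgen w
  have hπψφ : ∀ k ∈ φ.range, (π.comp ψ) k = 1 := by
    rintro _ ⟨a, rfl⟩
    rw [MonoidHom.comp_apply, hψφ]
    exact (hex.le ⟨_, rfl⟩ : _ ∈ π.ker)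
  -- The given quotient group embeds into the quotient by `θ`, since `κ ∘ θ` is the inverse of `αH`.
  let κ : P.Group ⧸ φ.range →* H := QuotientGroup.lift φ.range (π.comp ψ) hπψφ
  have hκθ : ∀ h, κ (θ h) = αH.symm h := by
    intro h
    obtain ⟨w, rfl⟩ := PH.classOf_surjective h
    have h1 := Presentation.map_classOf (κ.comp θ) w
    have h2 := Presentation.map_classOf αH.symm.toMonoidHom w
    simp only [MonoidHom.comp_apply, MulEquiv.coe_toMonoidHom] at h1 h2
    rw [h1, h2]
    congr 1
    funext i
    rw [← hX, hθ]
    simp only [Word.eval_cons, Word.eval_nil, zpow_one, mul_one]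
    change π (ψ (P.classOf [(Fin.natAdd _ i, 1)])) = _
    rw [hψ]
    simp [Word.eval_cons, Word.eval_nil]
  have hinj : Function.Injective ψ := by
    rw [injective_iff_map_eq_one]
    intro k hk
    obtain ⟨h, hh⟩ := hθsurj k
    have h1 : κ (QuotientGroup.mk' φ.range k) = 1 := by
      change π (ψ k) = 1
      rw [hk, map_one]
    rw [← hh, hκθ, EmbeddingLike.map_eq_one_iff] at h1
    rw [h1, map_one] at hh
    obtain ⟨a, rfl⟩ := (QuotientGroup.eq_one_iff k).1 hh.symm
    rw [hψφ, map_eq_one_iff _ hι, EmbeddingLike.map_eq_one_iff] at hk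
    rw [hk, map_one]
  have hsurj : Function.Surjective ψ := by
    intro g
    obtain ⟨w, hw⟩ := PH.classOf_surjective (αH (π g))
    let k := P.classOf (w.mapGens (Fin.natAdd _))
    have hk : π (ψ k) = π g := by
      have h2 := Presentation.map_classOf αH.symm.toMonoidHom w
      simp only [MulEquiv.coe_toMonoidHom, hw, MulEquiv.symm_apply_apply] at h2
      have h3 := Presentation.map_classOf (π.comp ψ) (w.mapGens (Fin.natAdd _) : Word P.gens)
      simp only [MonoidHom.comp_apply] at h3
      rw [h2, h3, Word.eval_mapGens]
      congr 1
      funext i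
      rw [hψ, ← hX]
      simp [Word.eval_cons, Word.eval_nil]
    have hker : g * (ψ k)⁻¹ ∈ ι.range := by
      rw [hex, MonoidHom.mem_ker, map_mul, map_inv, hk, mul_inv_cancel]
    obtain ⟨a, ha⟩ := hker
    refine ⟨φ (αN a) * k, ?_⟩
    rw [map_mul, hψφ, MulEquiv.symm_apply_apply, ha, inv_mul_cancel_right]
  refine ⟨(MulEquiv.ofBijective ψ ⟨hinj, hsurj⟩).symm, fun w => ?_⟩
  rw [MulEquiv.symm_symm, ← hψ]
  rfl

/-! ### Sizes of data -/

namespace Data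

theorem finite_size_le (n : ℕ) : {d : Data | d.size ≤ n}.Finite := by
  induction n with
  | zero =>
    convert Set.finite_empty
    ext d
    cases d <;> simp [size]
  | succ n ih =>
    refine ((ih.image2 pair ih).union (Set.finite_singleton nil)).subset ?_
    rintro (_ | ⟨a, b⟩) h
    · exact Or.inr rfl
    · simp only [Set.mem_ofPred_eq, size] at h
      exact Or.inl ⟨a, by simp only [Set.mem_ofPred_eq]; omega, b,
        by simp only [Set.mem_ofPred_eq]; omega, rfl⟩

end Data

/-- Every element has a code, and there are only finitely many data of bounded length. -/
theorem BlackBoxGroup.finite {G : Type*} [Group G] (B : BlackBoxGroup G) : Finite G := by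
  choose c hc using B.exists_code
  have := (Data.finite_size_le B.maxLen).to_subtype
  refine Finite.of_injective (β := {d : Data | d.size ≤ B.maxLen})
    (fun g => ⟨c g, B.size_le _ _ (hc g)⟩) fun g h hgh => ?_
  have : c g = c h := congrArg Subtype.val hgh
  have h1 := hc g
  rw [this, hc h] at h1
  exact (Option.some.inj h1).symm

/-! ### Evaluation of words in the extension group -/

/- The programs use fixed registers. The registers `20` to `29` belong to the evaluation of words
and `10` to `15` to the concatenation and renaming of words; the registers from `30` on hold data that
these routines read but do not change. -/

/-- A sequence of programs. -/
def Prog.block {O : Type} : List (Prog O) → Prog O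
  | [] => .skip
  | [p] => p
  | p :: l => .seq p (block l)

/-- The stores agree outside the registers `lo, …, hi - 1`. -/
def AgreeOff (lo hi : ℕ) (s s' : Store) : Prop := ∀ r, r < lo ∨ hi ≤ r → s' r = s r

theorem AgreeOff.refl {lo hi : ℕ} (s : Store) : AgreeOff lo hi s s := fun _ _ => rfl

theorem AgreeOff.trans {lo hi : ℕ} {s s' s'' : Store} (h : AgreeOff lo hi s s')
    (h' : AgreeOff lo hi s' s'') : AgreeOff lo hi s s'' :=
  fun r hr => (h' r hr).trans (h r hr)

theorem AgreeOff.update {lo hi : ℕ} {s s' : Store} (h : AgreeOff lo hi s s') {x : ℕ}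
    (hx : lo ≤ x ∧ x < hi) (d : Data) : AgreeOff lo hi s (Function.update s' x d) := by
  intro r hr
  rw [Function.update_of_ne (by omega)]
  exact h r hr

namespace Extension

variable {N G H : Type*} [Group N] [Group G] [Group H]

/-- All quantities that enter the analysis of the programs are at most `W`: the lengths of codes,
of the written presentations and of a list of codes of all generators, and the (expected) times of
the given algorithms on those inputs on which they are called. -/
structure BoundedBy (S : Extension N G H) (W : ℕ) : Prop where
  one_le : 1 ≤ W
  sizeN : ∀ c g, S.boxN.decode c = some g → c.size ≤ W
  sizeG : ∀ c g, S.boxG.decode c = some g → c.size ≤ W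
  sizeH : ∀ c g, S.boxH.decode c = some g → c.size ≤ W
  presN : S.presN.pres.encode.size ≤ W
  presH : S.presH.pres.encode.size ≤ W
  genCodes : ∀ l : List Data, l.length ≤ S.presN.pres.gens + S.presH.pres.gens →
    (∀ c ∈ l, ∃ g, S.boxG.decode c = some g) → (Data.ofList l).size ≤ W
  mulG : ∀ x y g h, S.boxG.decode x = some g → S.boxG.decode y = some h →
    S.boxG.mul.time (.pair x y) ≤ W
  invG : ∀ x g, S.boxG.decode x = some g → S.boxG.inv.time x ≤ W
  applyι : ∀ c g, S.boxN.decode c = some g → S.mapι.apply.time c ≤ W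
  preimageι : ∀ c g, S.boxG.decode c = some g → g ∈ S.ι.range → S.mapι.preimage.time c ≤ W
  applyπ : ∀ c g, S.boxG.decode c = some g → S.mapπ.apply.time c ≤ W
  preimageπ : ∀ c g, S.boxH.decode c = some g → g ∈ S.π.range → S.mapπ.preimage.time c ≤ W
  logN : ∀ c g, S.boxN.decode c = some g → S.presN.log.expectedTime c ≤ W
  logH : ∀ c g, S.boxH.decode c = some g → S.presH.log.expectedTime c ≤ W
  expN_nil : S.presN.exp.expectedTime .nil ≤ W
  expN : ∀ i : Fin S.presN.pres.gens, S.presN.exp.expectedTime (Word.encode [(i, 1)]) ≤ W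
  expH : ∀ i : Fin S.presH.pres.gens, S.presH.exp.expectedTime (Word.encode [(i, 1)]) ≤ W

/-- Multiply the codes in the registers `a` and `b` and write the product to register `z`. -/
def multiply (z a b : ℕ) : Prog Subroutine :=
  .block [.copy 26 b, .push 26 a, .call .mulG z 26]

/-- Write the entry of the list in register `32` whose index is given in unary in register `23`
to register `25`. -/
def lookupGen : Prog Subroutine :=
  .block [.copy 24 32, .forEach 25 23 (.pop 25 24), .pop 25 24]

/-- Multiply the code in register `21` with the power of the code in register `25` whose exponent
has its binary digits in register `22`. -/
def powMul : Prog Subroutine :=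
  .forEach 23 22 (.block [.ifNil 23 .skip (multiply 21 21 25), multiply 25 25 25])

/-- Multiply the code in register `21` with the value of the letter in register `22`. -/
def evalLetter : Prog Subroutine :=
  .block [.pop 23 22, lookupGen, .pop 23 22, .ifNil 23 .skip (.call .invG 25 25), powMul]

/-- Evaluate the word in register `20` and write the result to register `21`. Register `30` holds
a code of `1` and register `32` the list of codes of the generators. -/
def evalWord : Prog Subroutine :=
  .block [.copy 21 30, .forEach 22 20 evalLetter]

variable {S : Extension N G H} {W : ℕ}

theorem det_multiply (hB : S.BoundedBy W) {z a b : ℕ} (ha : a ≠ 26) {s : Store} {g h : G}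
    (hg : S.boxG.decode (s a) = some g) (hh : S.boxG.decode (s b) = some h)
    {Q : Store → ℕ → Prop}
    (hQ : ∀ e d t, S.boxG.decode d = some (g * h) → t ≤ 9 * W →
      Q (Function.update (Function.update s 26 e) z d) t) :
    Det S.env (multiply z a b) s Q := by
  apply det_seq
  apply det_copy.2
  apply det_seq
  apply det_push.2
  refine (det_call (A := S.boxG.mul) rfl).2 ?_
  rw [Function.update_idem]
  simp only [Function.update_self, Function.update_of_ne ha]
  refine hQ _ _ _ (S.boxG.mul_spec _ _ _ _ hg hh) ?_
  have h1 := hB.sizeG _ _ hg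
  have h2 := hB.sizeG _ _ hh
  have h3 := hB.mulG _ _ _ _ hg hh
  have h4 := hB.one_le
  simp only [Data.size]
  omega

theorem det_powMul (hB : S.BoundedBy W) {s : Store} {a g : G}
    (ha : S.boxG.decode (s 21) = some a) (hg : S.boxG.decode (s 25) = some g) (n : ℕ)
    (hn : s 22 = Data.ofList (n.bits.map Data.ofBool)) :
    Det S.env powMul s fun s' t => S.boxG.decode (s' 21) = some (a * g ^ n) ∧
      AgreeOff 20 30 s s' ∧ t ≤ (1 + 19 * W) * (s 22).size := by
  -- The number with the given binary digits, least significant digit first. The product of the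
  -- accumulator with the power of the current square by the remaining digits is invariant.
  let val : List Bool → ℕ := fun bs => Nat.ofDigits 2 (bs.map fun b => cond b 1 0)
  refine det_forEach (fun l s' => ∃ bs b h, l = bs.map Data.ofBool ∧
    S.boxG.decode (s' 21) = some b ∧ S.boxG.decode (s' 25) = some h ∧
    b * h ^ val bs = a * g ^ n ∧ AgreeOff 20 30 s s') (19 * W) ?_ ?_ ?_
  · refine ⟨n.bits, a, g, ?_, ha, hg, ?_, AgreeOff.refl s⟩
    · rw [hn, Data.toList_ofList]
    · simp only [val]
      rw [← Nat.digits_two_eq_bits, Nat.ofDigits_digits]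
  · rintro d l s' ⟨bs, b, h, hl, hb, hh, hv, hs⟩
    obtain ⟨β, bs, rfl⟩ : ∃ β bs', bs = β :: bs' := by
      cases bs with
      | nil => simp at hl
      | cons β bs => exact ⟨_, _, rfl⟩
    simp only [List.map_cons, List.cons.injEq] at hl
    obtain ⟨rfl, rfl⟩ := hl
    have hval : val (β :: bs) = cond β 1 0 + 2 * val bs := by
      simp only [val, List.map_cons, Nat.ofDigits_cons]
    have hW : 19 * W ≤ 19 * W * (1 + (Data.ofBool β).size) := Nat.le_mul_of_pos_right _ (by omega)
    have h1 := hB.one_le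
    rw [hval] at hv
    -- Whatever the digit, the round ends with the squaring.
    have hsq : ∀ s'' : Store, AgreeOff 20 30 s s'' → S.boxG.decode (s'' 25) = some h →
        ∀ t₀, t₀ ≤ 10 * W → ∀ b', S.boxG.decode (s'' 21) = some b' → b' = b * h ^ cond β 1 0 →
        Det S.env (multiply 25 25 25) s'' fun s₁ t => (∃ bs' b h, bs.map Data.ofBool =
            bs'.map Data.ofBool ∧ S.boxG.decode (s₁ 21) = some b ∧
          S.boxG.decode (s₁ 25) = some h ∧ b * h ^ val bs' = a * g ^ n ∧ AgreeOff 20 30 s s₁) ∧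
            t₀ + t ≤ 19 * W * (1 + (Data.ofBool β).size) := by
      intro s'' hs'' hh'' t₀ ht₀ b' hb' hbb'
      refine det_multiply hB (by decide) hh'' hh'' fun e d t hd ht => ⟨?_, by omega⟩
      refine ⟨bs, b', h * h, rfl, by simpa [Function.update_apply] using hb', by simpa using hd, ?_,
        (hs''.update (by decide) _).update (by decide) _⟩
      rw [← hv, hbb', pow_add, pow_mul, pow_two, mul_assoc]
    apply det_seq
    apply det_ifNil
    · intro hβ
      apply det_skip.2
      refine hsq _ (hs.update (by decide) _) (by simpa [Function.update_apply] using hh) _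
        (by omega) b (by simpa [Function.update_apply] using hb) ?_
      cases β
      · simp
      · simp [Data.ofBool] at hβ
    · intro hβ
      refine det_multiply hB (by decide) (g := b) (h := h)
        (by simpa [Function.update_apply] using hb)
        (by simpa [Function.update_apply] using hh) fun e d t hd ht => ?_
      refine hsq _ (((hs.update (by decide) _).update (by decide) _).update (by decide) _)
        (by simpa [Function.update_apply] using hh) _ (by omega) (b * h)
        (by simpa [Function.update_apply] using hd) ?_
      cases β
      · simp [Data.ofBool] at hβ
      · simp
  · rintro s' t ⟨bs, b, h, hl, hb, -, hv, hs⟩ ht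
    have : bs = [] := by simpa using hl.symm
    subst this
    refine ⟨?_, hs, ht⟩
    rw [hb, ← hv]
    simp [val]

/-- Register `30` holds a code of `1` and register `32` the list of codes of the elements `γ`. -/
def HoldsGens (S : Extension N G H) {k : ℕ} (γ : Fin k → G) (s : Store) : Prop :=
  S.boxG.decode (s 30) = some 1 ∧ ∃ cs : Fin k → Data, s 32 = Data.ofList (List.ofFn cs) ∧
    ∀ i, S.boxG.decode (cs i) = some (γ i)

theorem HoldsGens.agreeOff {k : ℕ} {γ : Fin k → G} {s s' : Store} (h : S.HoldsGens γ s)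
    {lo hi : ℕ} (hs : AgreeOff lo hi s s') (hhi : hi ≤ 30) : S.HoldsGens γ s' := by
  rw [HoldsGens, hs 30 (by omega), hs 32 (by omega)]
  exact h

theorem HoldsGens.size_le (hB : S.BoundedBy W) {k : ℕ}
    (hk : k = S.presN.pres.gens + S.presH.pres.gens) {γ : Fin k → G} {s : Store}
    (h : S.HoldsGens γ s) : (s 32).size ≤ W := by
  obtain ⟨-, cs, hcs, hγ⟩ := h
  rw [hcs]
  refine hB.genCodes _ (by simp [hk]) fun c hc => ?_
  obtain ⟨i, rfl⟩ := (List.mem_ofFn' _ _).1 hc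
  exact ⟨_, hγ i⟩

theorem det_lookupGen (hB : S.BoundedBy W) {k : ℕ}
    (hk : k = S.presN.pres.gens + S.presH.pres.gens) {γ : Fin k → G} {s : Store}
    (h : S.HoldsGens γ s) (i : Fin k) (hi : s 23 = Data.ofNat i) :
    Det S.env lookupGen s fun s' t => S.boxG.decode (s' 25) = some (γ i) ∧
      s' 21 = s 21 ∧ s' 22 = s 22 ∧ AgreeOff 20 30 s s' ∧ t ≤ 7 * W * (s 23).size := by
  have hsize := h.size_le hB hk
  obtain ⟨-, cs, hcs, hγ⟩ := h
  have h1 := hB.one_le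
  have hhead : ∀ n, (Data.ofList ((List.ofFn cs).drop n)).headSize ≤ W := by
    intro n
    refine ((Data.headSize_lt _).le.trans ?_).trans hsize
    rw [hcs]
    conv_rhs => rw [← List.take_append_drop n (List.ofFn cs)]
    have := Data.size_ofList_append ((List.ofFn cs).take n) ((List.ofFn cs).drop n)
    have := (Data.ofList ((List.ofFn cs).take n)).one_le_size
    omega
  apply det_seq
  apply det_copy.2
  apply det_seq
  refine det_forEach (fun l s' => s' 24 = Data.ofList ((List.ofFn cs).drop (i - l.length)) ∧
    l.length ≤ i ∧ s' 21 = s 21 ∧ s' 22 = s 22 ∧ AgreeOff 20 30 s s') (2 * W) ?_ ?_ ?_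
  · simp [hi, hcs, Data.ofNat, Data.toList_ofList,
      (AgreeOff.refl s).update (lo := 20) (hi := 30) (x := 24)]
  · rintro d l s' ⟨h24, hl, h21, h22, hs⟩
    apply det_pop.2
    simp only [List.length_cons] at hl h24
    refine ⟨⟨?_, by omega, by simpa [Function.update_apply] using h21,
      by simpa [Function.update_apply] using h22,
      ((hs.update (by decide) _).update (by decide) _).update (by decide) _⟩, ?_⟩
    · simp only [Function.update_apply]
      simp only [show (24 : ℕ) ≠ 25 by decide, if_true, if_false, h24]
      have hlt : (i : ℕ) - (l.length + 1) < (List.ofFn cs).length := by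
        rw [List.length_ofFn]; omega
      rw [List.drop_eq_getElem_cons hlt]
      simp only [Data.ofList, Data.tail]
      congr 2
      omega
    · rw [Function.update_of_ne (by decide), h24]
      have := hhead (i - (l.length + 1))
      have : 2 * W ≤ 2 * W * (1 + d.size) := Nat.le_mul_of_pos_right _ (by omega)
      omega
  · rintro s' t ⟨h24, -, h21, h22, hs⟩ ht
    apply det_pop.2
    simp only [List.length_nil, Nat.sub_zero] at h24
    have hlt : (i : ℕ) < (List.ofFn cs).length := by
      rw [List.length_ofFn]; exact i.2
    refine ⟨?_, by simpa [Function.update_apply] using h21,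
      by simpa [Function.update_apply] using h22,
      (hs.update (by decide) _).update (by decide) _, ?_⟩
    · rw [Function.update_self, h24, List.drop_eq_getElem_cons hlt]
      simp only [Data.ofList, Data.head, List.getElem_ofFn]
      exact hγ i
    · have h3 := hhead i
      rw [← h24] at h3
      have h4 := (s 23).one_le_size
      rw [Function.update_of_ne (by decide)] at ht
      have h5 : (1 + 2 * W) * (s 23).size ≤ (3 * W) * (s 23).size :=
        Nat.mul_le_mul_right _ (by omega)
      have h6 : 4 * W ≤ 4 * W * (s 23).size := Nat.le_mul_of_pos_right _ (by omega)
      have h7 : 7 * W * (s 23).size = 3 * W * (s 23).size + 4 * W * (s 23).size := by ring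
      omega

theorem det_evalLetter (hB : S.BoundedBy W) {k : ℕ}
    (hk : k = S.presN.pres.gens + S.presH.pres.gens) {γ : Fin k → G} {s : Store}
    (h : S.HoldsGens γ s) {a : G} (ha : S.boxG.decode (s 21) = some a) (i : Fin k) (e : ℤ)
    (hi : s 22 = Data.pair (Data.ofNat i) (Data.ofInt e)) :
    Det S.env evalLetter s fun s' t => S.boxG.decode (s' 21) = some (a * γ i ^ e) ∧
      AgreeOff 20 30 s s' ∧ t ≤ 40 * W * (1 + (s 22).size) := by
  have h1 := hB.one_le
  apply det_seq
  apply det_pop.2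
  rw [hi]
  simp only [Data.head, Data.tail, Data.headSize]
  apply det_seq
  have hs₁ : AgreeOff 20 30 s (Function.update (Function.update s 22 (Data.ofInt e)) 23
      (Data.ofNat i)) := ((AgreeOff.refl s).update (by decide) _).update (by decide) _
  refine (det_lookupGen hB hk (h.agreeOff hs₁ le_rfl) i (Function.update_self ..)).mono ?_
  rintro s₂ t₂ ⟨h25, h21, h22, hs₂, ht₂⟩
  rw [Function.update_self] at ht₂
  simp only [Function.update_apply] at h21 h22
  norm_num at h21 h22
  rw [← h21] at ha
  apply det_seq
  apply det_pop.2
  simp only [h22, Data.ofInt, Data.head, Data.tail, Data.headSize]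
  have hs₃ : AgreeOff 20 30 s (Function.update (Function.update s₂ 22
      (Data.ofList (e.natAbs.bits.map Data.ofBool))) 23 (Data.ofBool (decide (e < 0)))) :=
    ((hs₁.trans hs₂).update (by decide) _).update (by decide) _
  have hb : (Data.ofBool (decide (e < 0))).size ≤ 3 := by
    cases decide (e < 0) <;> simp [Data.ofBool, Data.size]
  have hsz : (Data.pair (Data.ofNat i) (Data.ofInt e)).size = 2 + (Data.ofNat i).size +
      (Data.ofBool (decide (e < 0))).size +
      (Data.ofList (e.natAbs.bits.map Data.ofBool)).size := by
    simp only [Data.ofInt, Data.size]; omega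
  have hbits := (Data.ofList (e.natAbs.bits.map Data.ofBool)).one_le_size
  -- Both signs of the exponent lead to the same loop, with base `γ i` or its inverse.
  have hfin : ∀ s₄ : Store, AgreeOff 20 30 s s₄ →
      s₄ 22 = Data.ofList (e.natAbs.bits.map Data.ofBool) →
      ∀ g, S.boxG.decode (s₄ 25) = some g → g ^ e.natAbs = γ i ^ e →
      S.boxG.decode (s₄ 21) = some a → ∀ t₄, t₄ ≤ 4 * W → Det S.env powMul s₄ fun s' t =>
        S.boxG.decode (s' 21) = some (a * γ i ^ e) ∧ AgreeOff 20 30 s s' ∧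
        1 + (Data.ofNat i).size + (t₂ + (1 + (Data.ofBool (decide (e < 0))).size + (t₄ + t))) ≤
          40 * W * (1 + (Data.pair (Data.ofNat i) (Data.ofInt e)).size) := by
    intro s₄ hs₄ h22 g hg hge h21 t₄ ht₄
    refine (det_powMul hB h21 hg _ h22).mono ?_
    rintro s' t ⟨h21, hs', ht⟩
    refine ⟨by rw [h21, hge], hs₄.trans hs', ?_⟩
    rw [hsz]
    rw [h22] at ht
    set x := (Data.ofNat i).size
    set y := (Data.ofBool (decide (e < 0))).size
    set z := (Data.ofList (e.natAbs.bits.map Data.ofBool)).size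
    have hx := Nat.mul_le_mul_right x h1
    have hy := Nat.mul_le_mul_right y h1
    have hz := Nat.mul_le_mul_right z h1
    nlinarith
  have h22' : (Function.update (Function.update s₂ 22
      (Data.ofList (e.natAbs.bits.map Data.ofBool))) 23 (Data.ofBool (decide (e < 0)))) 22 =
      Data.ofList (e.natAbs.bits.map Data.ofBool) := by simp
  apply det_seq
  apply det_ifNil
  · intro hn
    apply det_skip.2
    have he : 0 ≤ e := by
      by_contra hlt
      simp [Data.ofBool, not_le.1 hlt] at hn
    refine hfin _ hs₃ h22' (γ i) (by simpa [Function.update_apply] using h25) ?_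
      (by simpa [Function.update_apply] using ha) _ (by omega)
    rw [← zpow_natCast, Int.natAbs_of_nonneg he]
  · intro hn
    have he : e < 0 := by
      by_contra hlt
      simp [Data.ofBool, hlt] at hn
    refine (det_call (A := S.boxG.inv) rfl).2 ?_
    rw [Function.update_of_ne (by decide), Function.update_of_ne (by decide)]
    refine hfin _ (hs₃.update (by decide) _) (by simp) (γ i)⁻¹
      (by simpa using S.boxG.inv_spec _ _ h25) ?_
      (by simpa [Function.update_apply] using ha) _ ?_
    · rw [← zpow_natCast, Int.ofNat_natAbs_of_nonpos he.le, inv_zpow, zpow_neg, inv_inv]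
    · have h2 := hB.sizeG _ _ h25
      have h3 := hB.invG _ _ h25
      omega

/-- The time for the evaluation of a word is linear in its length. -/
theorem det_evalWord (hB : S.BoundedBy W) {k : ℕ}
    (hk : k = S.presN.pres.gens + S.presH.pres.gens) {γ : Fin k → G} {s : Store}
    (h : S.HoldsGens γ s) (w : Word k) (hw : s 20 = w.encode) :
    Det S.env evalWord s fun s' t => S.boxG.decode (s' 21) = some (w.eval γ) ∧
      AgreeOff 20 30 s s' ∧ t ≤ 43 * W * w.encode.size := by
  have h1 := hB.one_le
  apply det_seq
  apply det_copy.2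
  have h30 := hB.sizeG _ _ h.1
  refine det_forEach (fun l s' => ∃ (v : Word k) (b : G),
    l = v.map (fun l => Data.pair (Data.ofNat l.1) (Data.ofInt l.2)) ∧
    S.boxG.decode (s' 21) = some b ∧ b * v.eval γ = w.eval γ ∧ AgreeOff 20 30 s s')
    (40 * W) ?_ ?_ ?_
  · refine ⟨w, 1, ?_, by simpa using h.1, one_mul _, (AgreeOff.refl s).update (by decide) _⟩
    rw [Function.update_of_ne (by decide), hw, Word.encode, Data.toList_ofList]
  · rintro d l s' ⟨v, b, hl, hb, hv, hs⟩
    obtain ⟨x, v, rfl⟩ : ∃ x v', v = x :: v' := by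
      cases v with
      | nil => simp at hl
      | cons x v => exact ⟨_, _, rfl⟩
    simp only [List.map_cons, List.cons.injEq] at hl
    obtain ⟨rfl, rfl⟩ := hl
    have hs' := hs.update (x := 22) (by decide) (Data.pair (Data.ofNat x.1) (Data.ofInt x.2))
    refine (det_evalLetter hB hk (h.agreeOff hs' le_rfl)
      (by simpa [Function.update_apply] using hb) x.1 x.2 (Function.update_self ..)).mono ?_
    rintro s₁ t ⟨h21, hs₁, ht⟩
    refine ⟨⟨v, _, rfl, h21, ?_, hs'.trans hs₁⟩, by simpa using ht⟩
    rw [← hv, Word.eval_cons, mul_assoc]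
  · rintro s' t ⟨v, b, hl, hb, hv, hs⟩ ht
    have : v = [] := by simpa using hl.symm
    subst this
    refine ⟨?_, hs, ?_⟩
    · rw [hb, ← hv, Word.eval_nil, mul_one]
    · rw [Function.update_of_ne (by decide), hw] at ht
      have h2 := w.encode.one_le_size
      have := Nat.mul_le_mul_right w.encode.size h1
      nlinarith

end Extension

theorem Word.encode_append {n : ℕ} (v w : Word n) :
    (v ++ w).encode = Data.ofList (v.encode.toList ++ w.encode.toList) := by
  simp only [Word.encode, Data.toList_ofList, List.map_append]

theorem Word.size_encode_append {n : ℕ} (v w : Word n) :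
    (v ++ w).encode.size + 1 = v.encode.size + w.encode.size := by
  rw [Word.encode_append, Data.size_ofList_append, Data.ofList_toList, Data.ofList_toList]

theorem Word.encode_mapGens_castAdd {n m : ℕ} (w : Word n) :
    (w.mapGens (Fin.castAdd m)).encode = w.encode := by
  simp only [Word.encode, Word.mapGens, List.map_map]
  rfl

namespace Extension

variable {N G H : Type*} [Group N] [Group G] [Group H] {S : Extension N G H} {W : ℕ}

/-! ### The logarithm and the exponential map -/

/-- The loop that moves the list in register `y`, in reverse order, in front of the list in
register `x`. -/
theorem det_prepend {O : Type} {env : O → Algo} {x t y : ℕ} (hxt : x ≠ t) {s : Store} :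
    Det env (.forEach t y (.push x t)) s fun s' c =>
      s' x = Data.ofList ((s y).toList.reverse ++ (s x).toList) ∧
      (∀ r, r ≠ x → r ≠ t → s' r = s r) ∧ c ≤ 2 * (s y).size := by
  refine det_forEach (fun l s' => Data.ofList (l.reverse ++ (s' x).toList) =
      Data.ofList ((s y).toList.reverse ++ (s x).toList) ∧
      (∀ r, r ≠ x → r ≠ t → s' r = s r)) 1 ⟨rfl, fun _ _ _ => rfl⟩ ?_ ?_
  · rintro d l s' ⟨hx, hs⟩
    apply det_push.2
    refine ⟨⟨?_, fun r hr hr' => ?_⟩, ?_⟩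
    · rw [← hx]
      simp [Function.update_of_ne hxt, Data.toList]
    · rw [Function.update_of_ne hr, Function.update_of_ne hr', hs r hr hr']
    · simp
  · rintro s' c ⟨hx, hs⟩ hc
    refine ⟨?_, hs, by omega⟩
    rw [← hx]
    simp [Data.ofList_toList]

/-- Add the number in register `31` to the index of the letter in register `13`, and put the
letter in front of the list in register `12`. -/
def shiftLetter : Prog Subroutine :=
  .block [.pop 14 13, .forEach 15 31 (.push 14 15), .push 13 14, .push 12 13]

/-- Add the number in register `31` to all indices in the word in register `10`, and write the
result to register `11`. -/
def shiftWord : Prog Subroutine :=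
  .block [.clear 12, .forEach 13 10 shiftLetter, .clear 11, .forEach 13 12 (.push 11 13)]

theorem det_shiftLetter {m : ℕ} {s : Store} {i : ℕ} {d : Data} (hm : s 31 = Data.ofNat m)
    (hW : 2 * m + 1 ≤ W) (h13 : s 13 = .pair (Data.ofNat i) d) :
    Det S.env shiftLetter s fun s' t => s' 12 = .pair (.pair (Data.ofNat (m + i)) d) (s 12) ∧
      AgreeOff 11 16 s s' ∧ t ≤ 8 * W * (1 + (s 13).size) := by
  apply det_seq
  apply det_pop.2
  rw [h13]
  simp only [Data.head, Data.tail, Data.headSize]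
  apply det_seq
  refine (det_prepend (by decide)).mono ?_
  rintro s₁ t₁ ⟨h14, hs₁, ht₁⟩
  have h14' : s₁ 14 = Data.ofNat (m + i) := by
    rw [h14]
    simp [hm, Data.ofNat, Data.toList_ofList]
  have h13' : s₁ 13 = d := by
    rw [hs₁ 13 (by decide) (by decide)]; simp
  have h12' : s₁ 12 = s 12 := by
    rw [hs₁ 12 (by decide) (by decide)]; simp
  apply det_seq
  apply det_push.2
  apply det_push.2
  refine ⟨by simp [h14', h13', h12'], ?_, ?_⟩
  · have h1 : AgreeOff 11 16 s s₁ := by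
      intro r hr
      rw [hs₁ r (by omega) (by omega), Function.update_of_ne (by omega),
        Function.update_of_ne (by omega)]
    exact (h1.update (by decide) _).update (by decide) _
  · simp only [Function.update_self, h14', h13', Data.size, Data.size_ofNat]
    have h31 : (Function.update (Function.update s 13 d) 14 (Data.ofNat i)) 31 = Data.ofNat m := by
      simpa [Function.update_apply] using hm
    rw [h31, Data.size_ofNat] at ht₁
    have h1 := d.one_le_size
    have h2 := Nat.mul_le_mul_right d.size (show 1 ≤ W by omega)
    have h3 := Nat.mul_le_mul_right i (show 1 ≤ W by omega)
    nlinarith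

theorem size_encode_mapGens_natAdd {m n : ℕ} (hW : 2 * m + 1 ≤ W) (w : Word n) :
    (w.mapGens (Fin.natAdd m)).encode.size ≤ W * w.encode.size := by
  induction w with
  | nil => simp [Word.mapGens, Word.encode, Data.ofList, Data.size]; omega
  | cons l w ih =>
    simp only [Word.mapGens, Word.encode, List.map_cons, Data.ofList, Data.size, Data.size_ofNat,
      Fin.val_natAdd] at ih ⊢
    have h1 := Nat.mul_le_mul_right (Data.ofInt l.2).size (show 1 ≤ W by omega)
    have h2 := Nat.mul_le_mul_right (l.1 : ℕ) (show 1 ≤ W by omega)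
    nlinarith

theorem det_shiftWord {m n : ℕ} {s : Store} (hm : s 31 = Data.ofNat m)
    (hW : 2 * m + 1 ≤ W) (w : Word n) (hw : s 10 = w.encode) :
    Det S.env shiftWord s fun s' t => s' 11 = (w.mapGens (Fin.natAdd m)).encode ∧
      AgreeOff 11 16 s s' ∧ t ≤ 13 * W * w.encode.size := by
  apply det_seq
  apply det_clear.2
  apply det_seq
  refine det_forEach (fun l s' => ∃ v : Word n,
    l = v.map (fun l => Data.pair (Data.ofNat l.1) (Data.ofInt l.2)) ∧
    (v.mapGens (Fin.natAdd m)).encode.toList.reverse ++ (s' 12).toList =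
      (w.mapGens (Fin.natAdd m)).encode.toList.reverse ∧ AgreeOff 11 16 s s')
    (8 * W) ?_ ?_ ?_
  · refine ⟨w, ?_, by simp [Data.toList], (AgreeOff.refl s).update (by decide) _⟩
    rw [Function.update_of_ne (by decide), hw, Word.encode, Data.toList_ofList]
  · rintro d l s' ⟨v, hl, hv, hs⟩
    obtain ⟨x, v, rfl⟩ : ∃ x v', v = x :: v' := by
      cases v with
      | nil => simp at hl
      | cons x v => exact ⟨_, _, rfl⟩
    simp only [List.map_cons, List.cons.injEq] at hl
    obtain ⟨rfl, rfl⟩ := hl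
    have hs' := hs.update (x := 13) (by decide) (Data.pair (Data.ofNat x.1) (Data.ofInt x.2))
    refine (det_shiftLetter (by rw [hs' 31 (by decide), hm]) hW
      (Function.update_self ..)).mono ?_
    rintro s₁ t ⟨h12, hs₁, ht⟩
    refine ⟨⟨v, rfl, ?_, hs'.trans hs₁⟩, by simpa using ht⟩
    rw [← hv, h12]
    simp [Word.encode, Word.mapGens, Data.toList_ofList, Data.toList]
  · rintro s' t ⟨v, hl, hv, hs⟩ ht
    have : v = [] := by simpa using hl.symm
    subst this
    apply det_seq
    apply det_clear.2
    refine (det_prepend (by decide)).mono ?_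
    rintro s₁ t₁ ⟨h11, hs₁, ht₁⟩
    have h12 : (Function.update s' 11 .nil 12).toList =
        (w.mapGens (Fin.natAdd m)).encode.toList.reverse := by
      rw [Function.update_of_ne (by decide)]
      simpa [Word.mapGens, Word.encode, Data.toList, Data.ofList] using hv
    refine ⟨?_, ?_, ?_⟩
    · rw [h11, h12]
      simp [Data.toList, Data.ofList_toList]
    · intro r hr
      rw [hs₁ r (by omega) (by omega), Function.update_of_ne (by omega), hs r hr]
    · have h3 : (Function.update s' 11 .nil 12).size =
          (w.mapGens (Fin.natAdd m)).encode.size := by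
        conv_lhs => rw [← Data.ofList_toList (Function.update s' 11 .nil 12), h12]
        conv_rhs => rw [← Data.ofList_toList (Word.encode _)]
        rw [Data.size_ofList, Data.size_ofList, List.map_reverse, List.sum_reverse]
      have h4 := size_encode_mapGens_natAdd hW w
      rw [Function.update_of_ne (by decide), hw] at ht
      have h5 := w.encode.one_le_size
      have h6 := Nat.mul_le_mul_right w.encode.size (show 1 ≤ W by omega)
      nlinarith

/-- The elements `γ` are the images of the generators of `N` and lifts of the generators of `H`,
where `αN` and `αH` are the isomorphisms of the given effective presentations. -/
structure Lifts (S : Extension N G H) (αN : N ≃* S.presN.pres.Group)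
    (αH : H ≃* S.presH.pres.Group) (γ : Fin (S.presN.pres.gens + S.presH.pres.gens) → G) :
    Prop where
  logN : ∀ c g, S.boxN.decode c = some g → ∀ o ∈ (S.presN.log c).support,
    ∃ w : Word S.presN.pres.gens, o.1 = w.encode ∧ S.presN.pres.classOf w = αN g
  logH : ∀ c g, S.boxH.decode c = some g → ∀ o ∈ (S.presH.log c).support,
    ∃ w : Word S.presH.pres.gens, o.1 = w.encode ∧ S.presH.pres.classOf w = αH g
  left : ∀ j, γ (Fin.castAdd _ j) = S.ι (αN.symm (S.presN.pres.classOf [(j, 1)]))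
  right : ∀ i, S.π (γ (Fin.natAdd _ i)) = αH.symm (S.presH.pres.classOf [(i, 1)])

variable {αN : N ≃* S.presN.pres.Group} {αH : H ≃* S.presH.pres.Group}
  {γ : Fin (S.presN.pres.gens + S.presH.pres.gens) → G}

theorem Lifts.eval_castAdd (h : S.Lifts αN αH γ) (u : Word S.presN.pres.gens) :
    (u.mapGens (Fin.castAdd _)).eval γ = S.ι (αN.symm (S.presN.pres.classOf u)) := by
  have := Presentation.map_classOf (S.ι.comp αN.symm.toMonoidHom) u
  simp only [MonoidHom.comp_apply, MulEquiv.coe_toMonoidHom] at this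
  rw [Word.eval_mapGens, this]
  congr 1
  funext j
  exact h.left j

theorem Lifts.map_eval_natAdd (h : S.Lifts αN αH γ) (w : Word S.presH.pres.gens) :
    S.π ((w.mapGens (Fin.natAdd _)).eval γ) = αH.symm (S.presH.pres.classOf w) := by
  have := Presentation.map_classOf αH.symm.toMonoidHom w
  simp only [MulEquiv.coe_toMonoidHom] at this
  have h2 : S.π ((w.mapGens (Fin.natAdd _)).eval γ) =
      (w.mapGens (Fin.natAdd _)).eval fun i => S.π (γ i) := by
    induction w.mapGens (Fin.natAdd _) with
    | nil => simp [Word.eval_nil]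
    | cons l w ih => simp [Word.eval_cons, ih]
  rw [h2, Word.eval_mapGens, this]
  congr 1
  funext i
  exact h.right i

theorem BoundedBy.two_mul_gens_lt (hB : S.BoundedBy W) :
    2 * S.presN.pres.gens + 1 ≤ W ∧ 2 * S.presH.pres.gens + 1 ≤ W := by
  have h1 := hB.presN
  have h2 := hB.presH
  simp only [Presentation.encode, Data.size, Data.size_ofNat] at h1 h2
  omega

/-- For a code of `g` in register `3` and a word `v` in register `11`, compute a code of the element
`n` of `N` with `g = n v`, and write it to register `21`. -/
def quotientCode : Prog Subroutine :=
  .block [.copy 20 11, evalWord, .call .invG 21 21, multiply 21 3 21, .call .preimageι 21 21]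

/-- For a code of `g` in register `3` and a word `v` in register `11` with the same image in `H`,
extend `v` on the left by a word in the generators of `N` to a word for `g`. -/
def completeWord : Prog Subroutine :=
  .seq quotientCode (.seq (.call .logN 10 21)
    (.block [.clear 12, .forEach 13 10 (.push 12 13), .forEach 13 12 (.push 11 13)]))

theorem det_quotientCode (hB : S.BoundedBy W) {s : Store} (hs : S.HoldsGens γ s)
    (v : Word (S.presN.pres.gens + S.presH.pres.gens)) (hv : s 11 = v.encode) {g : G}
    (hg : S.boxG.decode (s 3) = some g) (hgv : S.π g = S.π (v.eval γ)) :
    Det S.env quotientCode s fun s' t => (∃ n, S.boxN.decode (s' 21) = some n ∧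
      S.ι n * v.eval γ = g) ∧ AgreeOff 20 30 s s' ∧ t ≤ 60 * W * v.encode.size := by
  have h1 := hB.one_le
  apply det_seq
  apply det_copy.2
  apply det_seq
  have hs₁ := (AgreeOff.refl s).update (lo := 20) (hi := 30) (x := 20) (by decide) (s 11)
  refine (det_evalWord hB rfl (hs.agreeOff hs₁ le_rfl) v
    (by rw [Function.update_self, hv])).mono ?_
  rintro s₂ t₂ ⟨h21, hs₂, ht₂⟩
  have hs₂' := hs₁.trans hs₂
  apply det_seq
  refine (det_call (A := S.boxG.inv) rfl).2 ?_
  have ht₃ := hB.invG _ _ h21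
  have hz₃ := hB.sizeG _ _ h21
  apply det_seq
  refine det_multiply hB (g := g) (h := (v.eval γ)⁻¹) (by decide) ?_ ?_ ?_
  · rw [Function.update_of_ne (by decide), hs₂' 3 (by decide), hg]
  · rw [Function.update_self]
    exact S.boxG.inv_spec _ _ h21
  intro e d t₄ hd ht₄
  refine (det_call (A := S.mapι.preimage) rfl).2 ?_
  rw [Function.update_self, Function.update_self]
  have hmem : g * (v.eval γ)⁻¹ ∈ S.ι.range := by
    rw [S.exact, MonoidHom.mem_ker, map_mul, map_inv, hgv, mul_inv_cancel]
  obtain ⟨n, hn, hn'⟩ := S.mapι.preimage_spec _ _ hd hmem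
  have hz₅ := hB.sizeG _ _ hd
  have ht₅ := hB.preimageι _ _ hd hmem
  refine ⟨⟨n, hn, by rw [hn', inv_mul_cancel_right]⟩, ?_, ?_⟩
  · exact (((hs₂'.update (by decide) _).update (by decide) _).update (by decide) _).update
      (by decide) _
  · rw [hv]
    have := v.encode.one_le_size
    have := Nat.mul_le_mul_right v.encode.size h1
    have : W ≤ W * v.encode.size := Nat.le_mul_of_pos_right _ (by omega)
    have : 60 * W * v.encode.size = 43 * W * v.encode.size + 17 * (W * v.encode.size) := by ring
    omega

/-- Register `11` ends with a word of random length. Its length may be charged with any slope `K`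
in the potential, because the logarithm in `N` is applied to a code, whose length is bounded, and
the random word that it returns is only copied. -/
theorem triple_completeWord (hB : S.BoundedBy W) (hL : S.Lifts αN αH γ) {s : Store}
    (hs : S.HoldsGens γ s) (v : Word (S.presN.pres.gens + S.presH.pres.gens))
    (hv : s 11 = v.encode) {g : G} (hg : S.boxG.decode (s 3) = some g)
    (hgv : S.π g = S.π (v.eval γ)) (K : ℕ) :
    Triple S.env completeWord s
      (fun s' => ∃ u : Word S.presN.pres.gens, s' 11 = (u.mapGens (Fin.castAdd _) ++ v).encode ∧
        (u.mapGens (Fin.castAdd _) ++ v).eval γ = g ∧ AgreeOff 10 30 s s')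
      (fun s' => ((K * (s' 11).size : ℕ) : ℝ≥0∞)) ((70 + 2 * K) * W * v.encode.size : ℕ) := by
  have h1 := hB.one_le
  refine (det_quotientCode hB hs v hv hg hgv).triple_seq (60 * W * v.encode.size)
    (c' := ((10 + 2 * K) * W * v.encode.size : ℕ)) (fun _ _ h => h.2.2) ?_ ?_
  · rintro s₁ - ⟨⟨n, hn, hng⟩, hs₁, -⟩
    refine triple_seq (R := fun s' => ∃ u : Word S.presN.pres.gens, s' 10 = u.encode ∧
        (u.mapGens (Fin.castAdd _) ++ v).eval γ = g ∧ s' 11 = v.encode ∧ AgreeOff 10 30 s s')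
      -- The word is moved twice, at `2` per unit each time, and then charged with slope `K`.
      (Ψ := fun s' => ((1 + K * v.encode.size + (4 + K) * (s' 10).size : ℕ) : ℝ≥0∞)) ?_ ?_
    · refine triple_call (env := S.env) (o := .logN)
          (D := fun d => ∃ u : Word S.presN.pres.gens, d = u.encode ∧
        (u.mapGens (Fin.castAdd _) ++ v).eval γ = g) (b := W)
        (a := (1 + K * v.encode.size : ℕ)) (K := (4 + K : ℕ)) ?_ (hB.logN _ _ hn) ?_ ?_ ?_
      · intro r hr
        obtain ⟨u, hu, hu'⟩ := hL.logN _ _ hn r hr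
        refine ⟨u, hu, ?_⟩
        rw [Word.eval_append, hL.eval_castAdd, hu', MulEquiv.symm_apply_apply, hng]
      · rintro d ⟨u, rfl, hu⟩
        refine ⟨u, by simp, hu, by rw [Function.update_of_ne (by decide), hs₁ 11 (by decide), hv],
          ?_⟩
        have : AgreeOff 10 30 s s₁ := fun r hr => hs₁ r (by omega)
        exact this.update (by decide) _
      · rintro d -
        simp only [Function.update_self]
        push_cast
        exact le_rfl
      · have h2 := hB.sizeN _ _ hn
        have h3 := v.encode.one_le_size
        have : 1 + (s₁ 21).size + (1 + K * v.encode.size) + (1 + (4 + K)) * W ≤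
            (10 + 2 * K) * W * v.encode.size := by
          have h4 : W ≤ W * v.encode.size := Nat.le_mul_of_pos_right _ (by omega)
          have h5 := Nat.mul_le_mul_left K h4
          have h6 := Nat.mul_le_mul_left K (Nat.mul_le_mul_right v.encode.size h1)
          nlinarith
        exact_mod_cast this
    · rintro s₂ ⟨u, h10, hu, h11, hs₂⟩
      have hdet : Det S.env (.block [.clear 12, .forEach 13 10 (.push 12 13),
          .forEach 13 12 (.push 11 13)]) s₂ fun s' t =>
          s' 11 = (u.mapGens (Fin.castAdd _) ++ v).encode ∧ AgreeOff 10 30 s s' ∧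
            t ≤ 1 + 4 * u.encode.size := by
        apply det_seq
        apply det_clear.2
        apply det_seq
        refine (det_prepend (by decide)).mono ?_
        rintro s₃ t₃ ⟨h12, hs₃, ht₃⟩
        refine (det_prepend (by decide)).mono ?_
        rintro s₄ t₄ ⟨h11', hs₄, ht₄⟩
        rw [Function.update_of_ne (by decide), h10] at ht₃
        rw [Function.update_self, Function.update_of_ne (by decide), h10] at h12
        refine ⟨?_, ?_, ?_⟩
        · rw [h11', h12, hs₃ 11 (by decide) (by decide), Function.update_of_ne (by decide), h11,
            Word.encode_append, Word.encode_mapGens_castAdd]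
          simp [Data.toList_ofList, Data.toList]
        · intro r hr
          rw [hs₄ r (by omega) (by omega), hs₃ r (by omega) (by omega),
            Function.update_of_ne (by omega), hs₂ r hr]
        · have : (s₃ 12).size = u.encode.size := by
            rw [h12, Data.toList, List.append_nil, Data.size_ofList, List.map_reverse,
              List.sum_reverse, ← Data.size_ofList, Data.ofList_toList]
          omega
      refine hdet.triple ?_
      rintro s' t ⟨h11', hs', ht⟩
      refine ⟨⟨u, h11', hu, hs'⟩, ?_⟩
      rw [h11', h10]
      have h2 := Word.size_encode_append (u.mapGens (Fin.castAdd S.presH.pres.gens)) v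
      rw [Word.encode_mapGens_castAdd] at h2
      have : t + K * (u.mapGens (Fin.castAdd S.presH.pres.gens) ++ v).encode.size ≤
          1 + K * v.encode.size + (4 + K) * u.encode.size := by
        have := Nat.mul_le_mul_left K h2.le
        nlinarith
      exact_mod_cast this
  · have : 60 * W * v.encode.size + (10 + 2 * K) * W * v.encode.size ≤
      (70 + 2 * K) * W * v.encode.size := by nlinarith
    exact_mod_cast this

/-- The auxiliary datum: a code of `1`, the number of generators of `N` and the list of codes of the
generators `γ` of `G`. -/
def IsAux (S : Extension N G H) {k : ℕ} (γ : Fin k → G) (d : Data) : Prop :=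
  ∃ (e : Data) (cs : Fin k → Data),
    d = .pair e (.pair (Data.ofNat S.presN.pres.gens) (Data.ofList (List.ofFn cs))) ∧
    S.boxG.decode e = some 1 ∧ ∀ i, S.boxG.decode (cs i) = some (γ i)

/-- Unpack the auxiliary datum and leave the other part of the input in register `0`. -/
def loadAux : Prog Subroutine := .block [.pop 1 0, .pop 30 1, .pop 31 1, .copy 32 1]

/-- The discrete logarithm in the extension. -/
def logProg : Prog Subroutine :=
  .seq (.block [loadAux, .copy 3 0, .call .applyπ 2 0]) (.seq (.call .logH 10 2)
    (.seq shiftWord (.seq completeWord (.copy 0 11))))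

/-- The exponential map of the extension. -/
def expProg : Prog Subroutine := .block [loadAux, .copy 20 0, evalWord, .copy 0 21]

theorem det_loadAux (hB : S.BoundedBy W) {a : Data} (ha : S.IsAux γ a) {s : Store} {c : Data}
    (h0 : s 0 = .pair a c) : Det S.env loadAux s fun s' t => s' 0 = c ∧ S.HoldsGens γ s' ∧
      s' 31 = Data.ofNat S.presN.pres.gens ∧ t ≤ 14 * W := by
  obtain ⟨e, cs, rfl, he, hcs⟩ := ha
  have h1 := hB.one_le
  have h2 := hB.sizeG _ _ he
  have h3 := hB.two_mul_gens_lt.1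
  have hG : ∀ s' : Store, s' 30 = e → s' 32 = Data.ofList (List.ofFn cs) → S.HoldsGens γ s' :=
    fun s' h30 h32 => ⟨by rw [h30, he], cs, h32, hcs⟩
  apply det_seq
  apply det_pop.2
  apply det_seq
  apply det_pop.2
  apply det_seq
  apply det_pop.2
  apply det_copy.2
  refine ⟨by simp [h0, Data.tail], hG _ (by simp [h0, Data.head])
    (by simp [h0, Data.head, Data.tail]), by simp [h0, Data.head, Data.tail], ?_⟩
  have h4 := (hG (fun r => if r = 30 then e else Data.ofList (List.ofFn cs)) (by simp)
    (by simp)).size_le hB rfl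
  norm_num at h4
  simp [h0, Data.head, Data.tail, Data.headSize, Data.size, Data.size_ofNat]
  omega

/-- The exponential map calls only deterministic subroutines, so it is deterministic. -/
theorem exec_expProg (hB : S.BoundedBy W) {a : Data} (ha : S.IsAux γ a)
    (w : Word (S.presN.pres.gens + S.presH.pres.gens)) :
    (∀ o ∈ (expProg.exec S.env (.pair a w.encode)).support,
      S.boxG.decode o.1 = some (w.eval γ)) ∧
    (expProg.exec S.env).expectedTime (.pair a w.encode) ≤ (70 * W * w.encode.size : ℕ) := by
  have h1 := hB.one_le
  have hdet : Det S.env expProg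
      (Function.update (fun _ => Data.nil) 0 (Data.pair a w.encode)) fun s' t =>
      S.boxG.decode (s' 0) = some (w.eval γ) ∧ t ≤ 69 * W * w.encode.size := by
    apply det_seq
    refine (det_loadAux hB ha (Function.update_self ..)).mono ?_
    rintro s₁ t₁ ⟨h0, hG, -, ht₁⟩
    apply det_seq
    apply det_copy.2
    apply det_seq
    refine (det_evalWord hB rfl (hG.agreeOff ((AgreeOff.refl _).update (lo := 20) (hi := 30)
      (by decide) _) le_rfl) w
      (by rw [Function.update_self, h0])).mono ?_
    rintro s₂ t₂ ⟨h21, -, ht₂⟩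
    apply det_copy.2
    refine ⟨by simpa using h21, ?_⟩
    rw [h0]
    have h2 := hB.sizeG _ _ h21
    have := w.encode.one_le_size
    have := Nat.mul_le_mul_right w.encode.size h1
    have : W ≤ W * w.encode.size := Nat.le_mul_of_pos_right _ (by omega)
    have : 69 * W * w.encode.size = 43 * W * w.encode.size + 26 * (W * w.encode.size) := by ring
    omega
  have hT := (hdet.triple (R := fun s' => S.boxG.decode (s' 0) = some (w.eval γ))
    (Φ := fun s => (s 0).size) (c := (70 * W * w.encode.size : ℕ)) ?_).exec
  · refine ⟨fun o ho => ?_, hT.2⟩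
    obtain ⟨s, hs, hos⟩ := hT.1 o ho
    rw [hos, hs]
  · rintro s' t ⟨h0, ht⟩
    refine ⟨h0, ?_⟩
    have h2 := hB.sizeG _ _ h0
    have : W ≤ W * w.encode.size := Nat.le_mul_of_pos_right _ w.encode.one_le_size
    have : t + (s' 0).size ≤ 70 * W * w.encode.size := by nlinarith
    exact_mod_cast this

theorem exec_logProg (hB : S.BoundedBy W) (hL : S.Lifts αN αH γ) {a : Data} (ha : S.IsAux γ a)
    {c : Data} {g : G} (hc : S.boxG.decode c = some g) :
    (∀ o ∈ (logProg.exec S.env (.pair a c)).support,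
      ∃ w : Word (S.presN.pres.gens + S.presH.pres.gens), o.1 = w.encode ∧ w.eval γ = g) ∧
    (logProg.exec S.env).expectedTime (.pair a c) ≤ (120 * W ^ 3 : ℕ) := by
  have h1 := hB.one_le
  have hdet : Det S.env (.block [loadAux, .copy 3 0, .call .applyπ 2 0])
      (Function.update (fun _ => Data.nil) 0 (Data.pair a c)) fun s' t =>
      (S.boxG.decode (s' 3) = some g ∧ S.boxH.decode (s' 2) = some (S.π g) ∧
        S.HoldsGens γ s' ∧ s' 31 = Data.ofNat S.presN.pres.gens) ∧ t ≤ 19 * W := by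
    apply det_seq
    refine (det_loadAux hB ha (Function.update_self ..)).mono ?_
    rintro s₁ t₁ ⟨h0, hG, h31, ht₁⟩
    apply det_seq
    apply det_copy.2
    refine (det_call (A := S.mapπ.apply) rfl).2 ?_
    rw [Function.update_of_ne (show (0 : ℕ) ≠ 3 by decide), h0]
    have h2 := hB.sizeG _ _ hc
    have h3 := hB.applyπ _ _ hc
    refine ⟨⟨by simpa using hc, by simpa using S.mapπ.apply_spec _ _ hc,
      (hG.agreeOff ((AgreeOff.refl _).update (lo := 0) (hi := 30) (by decide) _) le_rfl).agreeOff
        ((AgreeOff.refl _).update (lo := 0) (hi := 30) (by decide) _) le_rfl,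
      by simpa [Function.update_apply] using h31⟩, by omega⟩
  have hT : Triple S.env logProg (Function.update (fun _ => Data.nil) 0 (Data.pair a c))
      (fun s' => ∃ w : Word (S.presN.pres.gens + S.presH.pres.gens),
        s' 0 = w.encode ∧ w.eval γ = g) (fun s' => (s' 0).size) (120 * W ^ 3 : ℕ) := by
    refine hdet.triple_seq (19 * W) (c' := (98 * W ^ 3 : ℕ)) (fun _ _ h => h.2) ?_ ?_
    · rintro s₁ - ⟨⟨h3, h2, hG, h31⟩, -⟩
      refine triple_seq (R := fun s' => ∃ w : Word S.presH.pres.gens, s' 10 = w.encode ∧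
          S.presH.pres.classOf w = αH (S.π g) ∧ S.boxG.decode (s' 3) = some g ∧
          S.HoldsGens γ s' ∧ s' 31 = Data.ofNat S.presN.pres.gens)
        -- All later work is linear in the random length of the logarithm in `H`.
        (Ψ := fun s' => (89 * W ^ 2 * (s' 10).size : ℕ)) ?_ ?_
      · refine triple_call (env := S.env) (o := .logH)
          (D := fun d => ∃ w : Word S.presH.pres.gens, d = w.encode ∧
          S.presH.pres.classOf w = αH (S.π g)) (b := W) (a := 0) (K := (89 * W ^ 2 : ℕ))
          (hL.logH _ _ h2) (hB.logH _ _ h2) ?_ ?_ ?_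
        · rintro d ⟨w, rfl, hw⟩
          exact ⟨w, by simp, hw, by simpa using h3,
            hG.agreeOff ((AgreeOff.refl _).update (lo := 0) (hi := 30) (by decide) _) le_rfl,
            by simpa using h31⟩
        · rintro d -
          simp
        · have h4 := hB.sizeH _ _ h2
          have : 1 + (s₁ 2).size + 0 + (1 + 89 * W ^ 2) * W ≤ 98 * W ^ 3 := by
            have : W ≤ W ^ 3 := Nat.le_self_pow (by decide) W
            nlinarith
          exact_mod_cast this
      · rintro s₂ ⟨w, h10, hw, h3, hG, h31⟩
        refine (det_shiftWord h31 hB.two_mul_gens_lt.1 w h10).triple_seq (13 * W * w.encode.size)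
          (c' := (76 * W ^ 2 * w.encode.size : ℕ)) (fun _ _ h => h.2.2) ?_ ?_
        · rintro s₃ - ⟨h11, hs₃, -⟩
          have hgv : S.π g = S.π ((w.mapGens (Fin.natAdd _)).eval γ) := by
            rw [hL.map_eval_natAdd, hw, MulEquiv.symm_apply_apply]
          refine triple_seq ((triple_completeWord hB hL (hG.agreeOff hs₃ (by decide)) _ h11
            (by rw [hs₃ 3 (by decide)]; exact h3) hgv 3).mono
            (c' := (76 * W ^ 2 * w.encode.size : ℕ))
            (Q' := fun s' => ∃ w : Word (S.presN.pres.gens + S.presH.pres.gens),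
              s' 11 = w.encode ∧ w.eval γ = g) (Φ' := fun s' => (3 * (s' 11).size : ℕ)) ?_ ?_) ?_
          · rintro s' ⟨u, h11, hu, -⟩
            exact ⟨⟨_, h11, hu⟩, le_rfl⟩
          · have h4 := size_encode_mapGens_natAdd hB.two_mul_gens_lt.1 w
            have : (70 + 2 * 3) * W * (w.mapGens (Fin.natAdd S.presN.pres.gens)).encode.size ≤
                76 * W ^ 2 * w.encode.size := by nlinarith
            exact_mod_cast this
          · rintro s₄ ⟨w', h11, hw'⟩
            refine (det_copy (Q := fun s' t => s' 0 = w'.encode ∧ t = 1 + w'.encode.size)).2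
              ⟨by simpa using h11, by rw [h11]⟩ |>.triple ?_
            rintro s' t ⟨h0, rfl⟩
            refine ⟨⟨w', h0, hw'⟩, ?_⟩
            rw [h0, h11]
            have := w'.encode.one_le_size
            have : 1 + w'.encode.size + w'.encode.size ≤ 3 * w'.encode.size := by omega
            exact_mod_cast this
        · have : 13 * W * w.encode.size + 76 * W ^ 2 * w.encode.size ≤
              89 * W ^ 2 * (s₂ 10).size := by
            rw [h10]
            have := Nat.mul_le_mul_right w.encode.size (Nat.le_self_pow (n := 2) (by decide) W)
            nlinarith
          exact_mod_cast this
    · have : 19 * W + 98 * W ^ 3 ≤ 120 * W ^ 3 := by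
        have : W ≤ W ^ 3 := Nat.le_self_pow (by decide) W
        omega
      exact_mod_cast this
  refine ⟨fun o ho => ?_, hT.exec.2⟩
  obtain ⟨s, ⟨w, hw, hg⟩, hos⟩ := hT.exec.1 o ho
  exact ⟨w, hos.trans hw, hg⟩

end Extension

/-! ### Construction of the presentation -/

/-- The stores agree on the registers in `L`. -/
def Keep (L : List ℕ) (s s' : Store) : Prop := ∀ r ∈ L, s' r = s r

theorem Keep.refl {L : List ℕ} (s : Store) : Keep L s s := fun _ _ => rfl

theorem Keep.trans {L : List ℕ} {s s' s'' : Store} (h : Keep L s s') (h' : Keep L s' s'') :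
    Keep L s s'' := fun r hr => (h' r hr).trans (h r hr)

theorem Keep.mono {L L' : List ℕ} {s s' : Store} (h : Keep L s s') (hL : L' ⊆ L) :
    Keep L' s s' := fun r hr => h r (hL hr)

theorem Keep.update {L : List ℕ} {s s' : Store} (h : Keep L s s') {x : ℕ} (hx : x ∉ L)
    (d : Data) : Keep L s (Function.update s' x d) := by
  intro r hr
  rw [Function.update_of_ne (by rintro rfl; exact hx hr)]
  exact h r hr

theorem AgreeOff.keep {lo hi : ℕ} {s s' : Store} (h : AgreeOff lo hi s s') {L : List ℕ}
    (hL : ∀ r ∈ L, r < lo ∨ hi ≤ r) : Keep L s s' := fun r hr => h r (hL r hr)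

namespace Extension

variable {N G H : Type*} [Group N] [Group G] [Group H] {S : Extension N G H} {W : ℕ}

/-- Put the letter with index in register `x` and exponent in register `e` in front of the word in
register `6`. -/
def pushLetter (x e : ℕ) : Prog Subroutine := .block [.copy 14 e, .push 14 x, .push 6 14]

theorem det_pushLetter {x e : ℕ} (hx : x ≠ 14) {s : Store} {i : ℕ} {d : Data}
    (hi : s x = Data.ofNat i) (hd : s e = d) (hiW : 2 * i + 1 ≤ 2 * W) (hdW : d.size ≤ 9)
    {Q : Store → ℕ → Prop}
    (hQ : ∀ s' t, s' 6 = .pair (.pair (Data.ofNat i) d) (s 6) →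
      (∀ r, r ≠ 6 → r ≠ 14 → s' r = s r) → t ≤ 30 * W → Q s' t) :
    Det S.env (pushLetter x e) s Q := by
  apply det_seq
  apply det_copy.2
  apply det_seq
  apply det_push.2
  apply det_push.2
  refine hQ _ _ ?_ ?_ ?_
  · simp [Function.update_of_ne hx, hi, hd]
  · intro r hr hr'
    rw [Function.update_of_ne hr, Function.update_of_ne hr', Function.update_of_ne hr']
  · simp only [Function.update_self, Function.update_of_ne hx, hi, hd, Data.size, Data.size_ofNat]
    omega

/-- Append the code of a generator to the list in register `32`: the index of the generator is in
register `4`, its code comes from the subroutine `e` for the exponential map, and `p` is the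
subroutine that brings it to `G`. Then increase the index by one. -/
def genBody (e p : Subroutine) : Prog Subroutine :=
  .seq (.block [.clear 6, pushLetter 4 16])
    (.seq (.call e 6 6) (.block [.call p 6 6, .push 32 6, .clear 5, .push 4 5]))

/-- The loop that finds codes in `G` for the generators of `N` or of `H`, given by their values `κ`;
`R i g` says that `g` is an admissible choice for the generator `i`. The subroutine `e` is random,
but all its possible answers are codes of the same element, and their length is bounded. -/
theorem triple_genLoop {K : Type*} [Group K] {B : BlackBoxGroup K} {e p : Subroutine}
    {A : DetAlgo} {n : ℕ} (hp : S.env p = A.toAlgo) {κ : Fin n → K} (R : Fin n → G → Prop)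
    (hn : 2 * n + 1 ≤ W)
    (hcode : ∀ c i, B.decode c = some (κ i) → c.size ≤ W ∧ A.time c ≤ W ∧
      ∃ g, S.boxG.decode (A c).1 = some g ∧ R i g)
    (hexp : ∀ i : Fin n, ∀ o ∈ (S.env e (Word.encode [(i, 1)])).support, B.decode o.1 = some (κ i))
    (htime : ∀ i : Fin n, (S.env e).expectedTime (Word.encode [(i, 1)]) ≤ W)
    {y : ℕ} {s : Store} (hy : s y = Data.ofNat n) (h4 : s 4 = .nil) (h16 : s 16 = Data.ofInt 1)
    {l₀ : List Data} (h32 : s 32 = Data.ofList l₀) :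
    Triple S.env (.forEach 5 y (genBody e p)) s
      (fun s' => ∃ cs : List Data, cs.length = n ∧ s' 32 = Data.ofList (cs.reverse ++ l₀) ∧
        (∀ (i : Fin n) (c : Data), cs[(i : ℕ)]? = some c →
          ∃ g, S.boxG.decode c = some g ∧ R i g) ∧ Keep [0, 1, 2, 16, 17, 30, 31] s s')
      (fun _ => 0) (1 + n * (2 + 60 * W) : ℕ) := by
  refine (triple_forEachNat hy (fun j s' => s' 4 = Data.ofNat j ∧ ∃ cs : List Data,
    cs.length = j ∧ s' 32 = Data.ofList (cs.reverse ++ l₀) ∧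
    (∀ (i : Fin n) (c : Data), cs[(i : ℕ)]? = some c → ∃ g, S.boxG.decode c = some g ∧ R i g) ∧
    Keep [0, 1, 2, 16, 17, 30, 31] s s') (60 * W) ?_ ?_).mono ?_ le_rfl
  · exact ⟨h4, [], rfl, h32, by simp, Keep.refl s⟩
  · rintro j s' hj ⟨h4, cs, hcs, h32, hR, hk⟩
    have hdet : Det S.env (.block [.clear 6, pushLetter 4 16]) (Function.update s' 5 .nil)
        fun s₁ t => (s₁ 6 = Word.encode [((⟨j, hj⟩ : Fin n), 1)] ∧ s₁ 4 = Data.ofNat j ∧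
          s₁ 32 = s' 32 ∧ Keep [0, 1, 2, 16, 17, 30, 31] s s₁) ∧ t ≤ 31 * W := by
      have hk' := (hk.update (x := 5) (by decide) .nil).update (x := 6) (by decide) .nil
      apply det_seq
      apply det_clear.2
      refine det_pushLetter (i := j) (d := Data.ofInt 1) (W := W) (by decide)
        (by simpa [Function.update_apply] using h4) (by rw [hk' 16 (by decide), h16]) (by omega)
        (by decide) ?_
      intro s₁ t h6 hs₁ ht
      refine ⟨⟨h6, ?_, ?_, ?_⟩, by omega⟩
      · rw [hs₁ 4 (by decide) (by decide)]; simpa [Function.update_apply] using h4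
      · rw [hs₁ 32 (by decide) (by decide)]; simp
      · refine hk'.trans fun r hr => hs₁ r ?_ ?_ <;> rintro rfl <;> simp at hr
    refine hdet.triple_seq (31 * W) (c' := (29 * W : ℕ)) (fun _ _ h => h.2) ?_ ?_
    · rintro s₁ - ⟨⟨h6, h4, h32', hk₁⟩, -⟩
      have h6s : (s₁ 6).size ≤ W + 10 := by
        have h7 : (Data.ofInt 1).size = 7 := by decide
        rw [h6]
        simp only [Word.encode, List.map_cons, List.map_nil, Data.ofList, Data.size,
          Data.size_ofNat, h7]
        omega
      refine triple_seq (R := fun s₂ => B.decode (s₂ 6) = some (κ ⟨j, hj⟩) ∧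
          s₂ 4 = Data.ofNat j ∧ s₂ 32 = s' 32 ∧ Keep [0, 1, 2, 16, 17, 30, 31] s s₂)
        (Ψ := fun _ => (8 * W : ℕ)) ?_ ?_
      · refine triple_call (D := fun d => B.decode d = some (κ ⟨j, hj⟩)) (b := W)
          (a := (8 * W : ℕ)) (K := 0) ?_ ?_ ?_ ?_ ?_
        · rw [h6]; exact hexp _
        · rw [h6]; exact htime _
        · exact fun d hd => ⟨by simpa using hd, by simpa using h4, by simpa using h32',
            hk₁.update (by decide) _⟩
        · simp
        · have : 1 + (s₁ 6).size + 8 * W + (1 + 0) * W ≤ 29 * W := by omega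
          exact_mod_cast this
      · rintro s₂ ⟨h6, h4, h32'', hk₂⟩
        obtain ⟨hsz, ht, g, hg, hRg⟩ := hcode _ _ h6
        have hdet₂ : Det S.env (.block [.call p 6 6, .push 32 6, .clear 5, .push 4 5]) s₂
            fun s₃ t => (s₃ 4 = Data.ofNat (j + 1) ∧ s₃ 32 = .pair (A (s₂ 6)).1 (s' 32) ∧
              Keep [0, 1, 2, 16, 17, 30, 31] s s₃) ∧ t ≤ 8 * W := by
          apply det_seq
          refine (det_call hp).2 ?_
          apply det_seq
          apply det_push.2
          apply det_seq
          apply det_clear.2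
          apply det_push.2
          refine ⟨⟨by simp [h4, Data.ofNat_succ], by simp [h32''],
            (((hk₂.update (by decide) _).update (by decide) _).update (by decide) _).update
              (by decide) _⟩, ?_⟩
          have hA : (A (s₂ 6)).1.size ≤ W := le_trans (Nat.le_add_left _ _) ht
          simp only [Function.update_self, Data.size]
          omega
        refine hdet₂.triple ?_
        rintro s₃ t ⟨⟨h4, h32₃, hk₃⟩, ht⟩
        refine ⟨⟨h4, cs ++ [(A (s₂ 6)).1], by simp [hcs], ?_, ?_, hk₃⟩, ?_⟩
        · rw [h32₃, h32]
          simp [Data.ofList]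
        · intro i c hc
          rw [List.getElem?_append] at hc
          split_ifs at hc with hlt
          · exact hR i c hc
          · have hij : (i : ℕ) = j := by
              by_contra hne
              rw [List.getElem?_eq_none (by simp only [List.length_singleton]; omega)] at hc
              simp at hc
            obtain rfl : i = ⟨j, hj⟩ := Fin.ext hij
            simp only [hcs, Nat.sub_self, List.getElem?_cons_zero, Option.some.injEq] at hc
            exact ⟨g, hc ▸ hg, hRg⟩
        · rw [add_zero]
          exact_mod_cast ht
    · have : 31 * W + 29 * W ≤ 60 * W := by omega
      exact_mod_cast this
  · rintro s' ⟨-, h⟩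
    exact ⟨h, le_rfl⟩

/-- The isomorphisms `αN` and `αH` are those of the given effective presentations. -/
structure Compatible (S : Extension N G H) (αN : N ≃* S.presN.pres.Group)
    (αH : H ≃* S.presH.pres.Group) : Prop where
  logN : ∀ c g, S.boxN.decode c = some g → ∀ o ∈ (S.presN.log c).support,
    ∃ w : Word S.presN.pres.gens, o.1 = w.encode ∧ S.presN.pres.classOf w = αN g
  expN : ∀ w : Word S.presN.pres.gens, ∀ o ∈ (S.presN.exp w.encode).support,
    S.boxN.decode o.1 = some (αN.symm (S.presN.pres.classOf w))
  logH : ∀ c g, S.boxH.decode c = some g → ∀ o ∈ (S.presH.log c).support,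
    ∃ w : Word S.presH.pres.gens, o.1 = w.encode ∧ S.presH.pres.classOf w = αH g
  expH : ∀ w : Word S.presH.pres.gens, ∀ o ∈ (S.presH.exp w.encode).support,
    S.boxH.decode o.1 = some (αH.symm (S.presH.pres.classOf w))

variable {αN : N ≃* S.presN.pres.Group} {αH : H ≃* S.presH.pres.Group}

/-- Unpack the input: the numbers of generators of `N` and `H` go to the registers `31` and `2`, the
relators to `1` and `0`. The registers `16` and `17` receive the exponents `1` and `-1`. -/
def unpackInput : Prog Subroutine :=
  .block [.pop 1 0, .pop 31 1, .pop 2 0, .clear 18, .clear 19, .push 19 18, .clear 16, .push 16 19,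
    .copy 17 16, .push 16 18, .push 17 19, .clear 3, .clear 4, .clear 32]

/-- Write a code of `1` to register `30` and the list of codes of generators of `G`, in reverse
order, to register `32`. -/
def chooseGens : Prog Subroutine :=
  .seq (.call .expN 3 3) (.seq (.call .applyι 30 3) (.seq (.forEach 5 31 (genBody .expN .applyι))
    (.seq (.clear 4) (.forEach 5 2 (genBody .expH .preimageπ)))))

/-- The unpacked input. -/
def Unpacked (S : Extension N G H) (s : Store) : Prop :=
  s 31 = Data.ofNat S.presN.pres.gens ∧ s 2 = Data.ofNat S.presH.pres.gens ∧
  s 1 = Data.ofList (S.presN.pres.rels.map Word.encode) ∧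
  s 0 = Data.ofList (S.presH.pres.rels.map Word.encode) ∧
  s 16 = Data.ofInt 1 ∧ s 17 = Data.ofInt (-1)

theorem Unpacked.keep {s s' : Store} (h : S.Unpacked s) (hs : Keep [0, 1, 2, 16, 17, 31] s s') :
    S.Unpacked s' := by
  simpa only [Unpacked, hs 0 (by decide), hs 1 (by decide), hs 2 (by decide), hs 16 (by decide),
    hs 17 (by decide), hs 31 (by decide)] using h

theorem det_unpackInput (hB : S.BoundedBy W) {s : Store} (h0 : s 0 = S.input) :
    Det S.env unpackInput s fun s' t => S.Unpacked s' ∧ s' 3 = .nil ∧ s' 4 = .nil ∧ s' 32 = .nil ∧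
      t ≤ 50 * W := by
  have h1 := hB.presN
  have h2 := hB.presH
  have h3 := hB.one_le
  have h4 := hB.two_mul_gens_lt
  apply det_seq
  apply det_pop.2
  apply det_seq
  apply det_pop.2
  apply det_seq
  apply det_pop.2
  iterate 2
    apply det_seq
    apply det_clear.2
  apply det_seq
  apply det_push.2
  apply det_seq
  apply det_clear.2
  apply det_seq
  apply det_push.2
  apply det_seq
  apply det_copy.2
  iterate 2
    apply det_seq
    apply det_push.2
  iterate 2
    apply det_seq
    apply det_clear.2
  apply det_clear.2
  refine ⟨⟨?_, ?_, ?_, ?_, ?_, ?_⟩, by simp, by simp, by simp, ?_⟩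
  · simp [h0, input, Presentation.encode, Data.head, Data.tail]
  · simp [h0, input, Presentation.encode, Data.head, Data.tail]
  · simp [h0, input, Presentation.encode, Data.head, Data.tail]
  · simp [h0, input, Presentation.encode, Data.head, Data.tail]
  · simp [Data.ofInt, Data.ofBool, Data.ofList]
  · simp [Data.ofInt, Data.ofBool, Data.ofList]
  · simp [h0, input, Data.head, Data.tail, Data.headSize, Data.size, Presentation.encode,
      Data.size_ofNat] at h1 h2 ⊢
    omega

theorem triple_chooseGens (hB : S.BoundedBy W) (hC : S.Compatible αN αH) {s : Store}
    (hU : S.Unpacked s) (h3 : s 3 = .nil) (h4 : s 4 = .nil) (h32 : s 32 = .nil) :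
    Triple S.env chooseGens s
      (fun s' => S.Unpacked s' ∧ S.boxG.decode (s' 30) = some 1 ∧
        ∃ (γ : Fin (S.presN.pres.gens + S.presH.pres.gens) → G)
          (cs : Fin (S.presN.pres.gens + S.presH.pres.gens) → Data), S.Lifts αN αH γ ∧
          s' 32 = Data.ofList (List.ofFn cs).reverse ∧ ∀ i, S.boxG.decode (cs i) = some (γ i))
      (fun _ => 0) (130 * W ^ 2 : ℕ) := by
  obtain ⟨h31, h2, -, -, h16, -⟩ := id hU
  have h1 := hB.one_le
  have hgens := hB.two_mul_gens_lt
  set m := S.presN.pres.gens with hm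
  set n := S.presH.pres.gens with hn
  refine triple_seq (R := fun s' => S.boxN.decode (s' 3) = some 1 ∧ s' 4 = .nil ∧ s' 32 = .nil ∧
      Keep [0, 1, 2, 16, 17, 31] s s')
    (Ψ := fun _ => (1 + 2 * W + (1 + m * (2 + 60 * W) + (1 + (1 + n * (2 + 60 * W)))) : ℕ)) ?_ ?_
  · refine triple_call (env := S.env) (o := .expN) (D := fun d => S.boxN.decode d = some 1) (b := W)
      (a := (1 + 2 * W + (1 + m * (2 + 60 * W) + (1 + (1 + n * (2 + 60 * W)))) : ℕ)) (K := 0)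
      ?_ ?_ ?_ ?_ ?_
    · intro r hr
      rw [h3] at hr
      have h5 := hC.expN [] r hr
      rwa [Presentation.classOf_eq_eval, Word.eval_nil, map_one] at h5
    · rw [h3]; exact hB.expN_nil
    · exact fun d hd => ⟨by simpa using hd, by simpa using h4, by simpa using h32,
        (Keep.refl s).update (by decide) _⟩
    · simp
    · have : 1 + (s 3).size + (1 + 2 * W + (1 + m * (2 + 60 * W) + (1 + (1 + n * (2 + 60 * W))))) +
          (1 + 0) * W ≤ 130 * W ^ 2 := by
        rw [h3, Data.size]
        have hmn : 2 * (m + n) + 2 ≤ 2 * W := by omega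
        have := Nat.mul_le_mul_right (1 + 30 * W) hmn
        nlinarith
      exact_mod_cast this
  · rintro s₁ ⟨h3, h4, h32, hk₁⟩
    have hdet : Det S.env (.call .applyι 30 3) s₁ fun s' t => (S.boxG.decode (s' 30) = some 1 ∧
        s' 4 = .nil ∧ s' 32 = .nil ∧ Keep [0, 1, 2, 16, 17, 31] s s') ∧ t ≤ 1 + 2 * W := by
      refine (det_call (A := S.mapι.apply) rfl).2 ?_
      have h5 := S.mapι.apply_spec _ _ h3
      rw [map_one] at h5
      refine ⟨⟨by simpa using h5, by simpa using h4, by simpa using h32,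
        hk₁.update (by decide) _⟩, ?_⟩
      have := hB.sizeN _ _ h3
      have := hB.applyι _ _ h3
      omega
    refine hdet.triple_seq (1 + 2 * W)
      (c' := (1 + m * (2 + 60 * W) + (1 + (1 + n * (2 + 60 * W))) : ℕ)) (fun _ _ h => h.2) ?_
      (by push_cast; exact le_rfl)
    rintro s₂ - ⟨⟨h30, h4, h32, hk₂⟩, -⟩
    have hloopN := triple_genLoop (S := S) (B := S.boxN) (e := .expN) (p := .applyι)
      (A := S.mapι.apply) rfl (κ := fun j => αN.symm (S.presN.pres.classOf [(j, 1)]))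
      (fun j g => g = S.ι (αN.symm (S.presN.pres.classOf [(j, 1)]))) hgens.1
      (fun c i hc => ⟨hB.sizeN _ _ hc, hB.applyι _ _ hc, _, S.mapι.apply_spec _ _ hc, rfl⟩)
      (fun i => hC.expN _) hB.expN (y := 31) (s := s₂) (by rw [hk₂ 31 (by decide), h31]) h4
      (by rw [hk₂ 16 (by decide), h16]) (l₀ := []) h32
    refine triple_seq ((hloopN.add_const ((1 + (1 + n * (2 + 60 * W)) : ℕ) : ℝ≥0∞)).mono
      (fun s' h => ⟨h, ?_⟩) ?_) (Ψ := fun _ => ((1 + (1 + n * (2 + 60 * W)) : ℕ) : ℝ≥0∞)) ?_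
    · simp
    · push_cast; exact le_rfl
    rintro s₃ ⟨csN, hlN, h32, hcsN, hk₃⟩
    have hk₃' : Keep [0, 1, 2, 16, 17, 31] s s₃ := hk₂.trans (hk₃.mono (by decide))
    refine (det_clear (Q := fun s' t => (S.boxG.decode (s' 30) = some 1 ∧
        s' 4 = .nil ∧ s' 32 = s₃ 32 ∧ Keep [0, 1, 2, 16, 17, 31] s s') ∧ t ≤ 1)).2
      ⟨⟨?_, by simp, by simp, hk₃'.update (by decide) _⟩, le_rfl⟩ |>.triple_seq 1
      (c' := (1 + n * (2 + 60 * W) : ℕ)) (fun _ _ h => h.2) ?_ (by push_cast; exact le_rfl)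
    · rw [Function.update_of_ne (by decide), hk₃ 30 (by decide), h30]
    rintro s₄ - ⟨⟨h30, h4, h32', hk₄⟩, -⟩
    have hloopH := triple_genLoop (S := S) (B := S.boxH) (e := .expH) (p := .preimageπ)
      (A := S.mapπ.preimage) rfl (κ := fun j => αH.symm (S.presH.pres.classOf [(j, 1)]))
      (fun j g => S.π g = αH.symm (S.presH.pres.classOf [(j, 1)])) hgens.2
      (fun c i hc => ⟨hB.sizeH _ _ hc, hB.preimageπ _ _ hc (S.π_surjective _),
        S.mapπ.preimage_spec _ _ hc (S.π_surjective _)⟩)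
      (fun i => hC.expH _) hB.expH (y := 2) (s := s₄) (by rw [hk₄ 2 (by decide), h2]) h4
      (by rw [hk₄ 16 (by decide), h16]) (h32'.trans h32)
    refine hloopH.mono (fun s' h => ⟨?_, le_rfl⟩) le_rfl
    obtain ⟨csH, hlH, h32, hcsH, hk₅⟩ := h
    have hk₅' : Keep [0, 1, 2, 16, 17, 31] s s' := hk₄.trans (hk₅.mono (by decide))
    refine ⟨hU.keep hk₅', by rw [hk₅ 30 (by decide), h30], ?_⟩
    have hlen : (csN ++ csH).length = m + n := by rw [List.length_append, hlN, hlH]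
    -- The codes for `N` come first; the list in register `32` is in reverse order.
    let cs : Fin (m + n) → Data := fun i => (csN ++ csH)[(i : ℕ)]'(by omega)
    have hofFn : List.ofFn cs = csN ++ csH := by
      refine List.ext_getElem (by simp [hlen]) fun i h h' => by simp [cs]
    have hleft : ∀ j, ∃ g, S.boxG.decode (cs (Fin.castAdd _ j)) = some g ∧
        g = S.ι (αN.symm (S.presN.pres.classOf [(j, 1)])) := by
      intro j
      refine hcsN j _ ?_
      simp only [cs, Fin.val_castAdd]
      rw [List.getElem_append_left (by omega), List.getElem?_eq_getElem]
    have hright : ∀ i, ∃ g, S.boxG.decode (cs (Fin.natAdd _ i)) = some g ∧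
        S.π g = αH.symm (S.presH.pres.classOf [(i, 1)]) := by
      intro i
      refine hcsH i _ ?_
      simp only [cs, Fin.val_natAdd]
      rw [List.getElem_append_right (by omega), List.getElem?_eq_getElem (by omega)]
      simp [hlN, hm]
    choose γN hγN hγN' using hleft
    choose γH hγH hγH' using hright
    refine ⟨Fin.append γN γH, cs, ⟨hC.logN, hC.logH, ?_, ?_⟩, ?_, ?_⟩
    · intro j
      rw [Fin.append_left]; exact hγN' j
    · intro i
      rw [Fin.append_right]; exact hγH' i
    · rw [h32, hofFn]
      simp
    · intro i
      induction i using Fin.addCases with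
      | left j => rw [Fin.append_left]; exact hγN j
      | right i => rw [Fin.append_right]; exact hγH i

end Extension

theorem Data.size_lt_of_mem {d : Data} {l : List Data} (h : d ∈ l) :
    d.size < (Data.ofList l).size := by
  rw [Data.size_ofList]
  have := List.le_sum_of_mem (List.mem_map_of_mem (f := fun d => 1 + d.size) h)
  omega

namespace Extension

variable {N G H : Type*} [Group N] [Group G] [Group H] {S : Extension N G H} {W : ℕ}
  {αN : N ≃* S.presN.pres.Group} {αH : H ≃* S.presH.pres.Group}
  {γ : Fin (S.presN.pres.gens + S.presH.pres.gens) → G}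

theorem HoldsGens.keep {k : ℕ} {γ : Fin k → G} {s s' : Store} (h : S.HoldsGens γ s)
    (hs : Keep [30, 32] s s') : S.HoldsGens γ s' := by
  rw [HoldsGens, hs 30 (by decide), hs 32 (by decide)]
  exact h

/-- The conjugate of a generator of `N` by a generator of `H`. -/
def conjWord (S : Extension N G H) (i : Fin S.presH.pres.gens) (j : Fin S.presN.pres.gens) :
    Word (S.presN.pres.gens + S.presH.pres.gens) :=
  [(Fin.natAdd _ i, 1), (Fin.castAdd _ j, 1), (Fin.natAdd _ i, -1)]

/-- The words whose values in `G` lie in `N` and have to be expressed by generators of `N`: the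
relators of `H` and the conjugates. -/
def kernelWords (S : Extension N G H) : Set (Word (S.presN.pres.gens + S.presH.pres.gens)) :=
  {v | (∃ t ∈ S.presH.pres.rels, v = t.mapGens (Fin.natAdd _)) ∨ ∃ i j, v = S.conjWord i j}

theorem Lifts.map_eval_kernelWords (hL : S.Lifts αN αH γ)
    {v : Word (S.presN.pres.gens + S.presH.pres.gens)} (hv : v ∈ S.kernelWords) :
    S.π (v.eval γ) = 1 := by
  rcases hv with ⟨t, ht, rfl⟩ | ⟨i, j, rfl⟩
  · rw [hL.map_eval_natAdd, Presentation.classOf_eq_one ht, map_one]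
  · have hj : S.π (γ (Fin.castAdd _ j)) = 1 := by
      rw [hL.left]
      exact (S.exact.le ⟨_, rfl⟩ : _ ∈ S.π.ker)
    simp [conjWord, Word.eval_cons, Word.eval_nil, hj]

theorem size_conjWord_le (hB : S.BoundedBy W) (i : Fin S.presH.pres.gens)
    (j : Fin S.presN.pres.gens) : (S.conjWord i j).encode.size ≤ 40 * W := by
  have h1 : (Data.ofInt 1).size = 7 := by decide
  have h2 : (Data.ofInt (-1)).size = 9 := by decide
  have := hB.two_mul_gens_lt
  simp only [conjWord, Word.encode, List.map_cons, List.map_nil, Data.ofList, Data.size,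
    Data.size_ofNat, Fin.val_natAdd, Fin.val_castAdd, h1, h2]
  omega

theorem size_relator_le (hB : S.BoundedBy W) {t : Word S.presH.pres.gens}
    (ht : t ∈ S.presH.pres.rels) : t.encode.size ≤ W := by
  have h1 := hB.presH
  have h2 := Data.size_lt_of_mem (List.mem_map_of_mem (f := Word.encode) ht)
  simp only [Presentation.encode, Data.size] at h1
  omega

theorem size_kernelWord_le (hB : S.BoundedBy W)
    {v : Word (S.presN.pres.gens + S.presH.pres.gens)} (hv : v ∈ S.kernelWords) :
    v.encode.size ≤ 40 * W ^ 2 := by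
  have h1 := hB.one_le
  rcases hv with ⟨t, ht, rfl⟩ | ⟨i, j, rfl⟩
  · have h2 := size_encode_mapGens_natAdd hB.two_mul_gens_lt.1 t
    have h3 := Nat.mul_le_mul_left W (size_relator_le hB ht)
    nlinarith
  · have := size_conjWord_le hB i j
    nlinarith

/-- Register `7` holds a list of `l` words from the set `A` that contains all words in `M`. -/
def Collected {k : ℕ} (A : Set (Word k)) (l : ℕ) (M : Set (Word k)) (s : Store) : Prop :=
  ∃ ks : List (Word k), s 7 = Data.ofList (ks.map Word.encode) ∧ ks.length = l ∧
    (∀ v ∈ ks, v ∈ A) ∧ ∀ v ∈ M, v ∈ ks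

theorem Collected.push {k : ℕ} {A : Set (Word k)} {l : ℕ} {M M' : Set (Word k)} {s s' : Store}
    (h : Collected A l M s) {v : Word k} (hv : v ∈ A) (hs : s' 7 = .pair v.encode (s 7))
    (hM : ∀ w ∈ M', w = v ∨ w ∈ M) : Collected A (l + 1) M' s' := by
  obtain ⟨ks, h7, hl, hA, hM'⟩ := h
  refine ⟨v :: ks, by rw [hs, h7]; rfl, by simp [hl], ?_, ?_⟩
  · simpa using ⟨hv, hA⟩
  · intro w hw
    rcases hM w hw with rfl | hw
    · simp
    · simp [hM' w hw]

theorem Collected.congr {k : ℕ} {A : Set (Word k)} {l l' : ℕ} {M M' : Set (Word k)}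
    {s s' : Store} (h : Collected A l M s) (hs : s' 7 = s 7) (hl : l = l') (hM : M' ⊆ M) :
    Collected A l' M' s' := by
  obtain ⟨ks, h7, hl', hA, hM'⟩ := h
  exact ⟨ks, hs.trans h7, hl'.trans hl, hA, fun v hv => hM' v (hM hv)⟩

/-- Put the next conjugate in front of the list in register `7`: its generator of `H` is in register
`4`, that of `N` in register `8`. Then increase the latter index. -/
def collectConj : Prog Subroutine :=
  .block [.clear 6, pushLetter 4 17, pushLetter 8 16, pushLetter 4 16, .push 7 6, .clear 9,
    .push 8 9]

/-- Prepare the loop over the relators: bring the list of codes of the generators in register `32`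
into the right order, and collect in register `7` all words whose values lie in `N`. -/
def collectWords : Prog Subroutine :=
  .block [.clear 6, .forEach 5 32 (.push 6 5), .copy 32 6, .clear 7,
    .forEach 10 0 (.block [shiftWord, .push 7 11]), .copy 4 31,
    .forEach 5 2 (.block [.clear 8, .forEach 9 31 collectConj, .clear 5, .push 4 5]),
    .clear 33, .copy 3 30]

theorem det_collectConj (hB : S.BoundedBy W) {s : Store} (hU : S.Unpacked s)
    {i : Fin S.presH.pres.gens} {j : Fin S.presN.pres.gens}
    (h4 : s 4 = Data.ofNat (S.presN.pres.gens + i)) (h8 : s 8 = Data.ofNat j) :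
    Det S.env collectConj s fun s' t => s' 7 = .pair (S.conjWord i j).encode (s 7) ∧
      s' 8 = Data.ofNat (j + 1) ∧ s' 4 = s 4 ∧ Keep [0, 1, 2, 16, 17, 30, 31, 32] s s' ∧
      t ≤ 140 * W := by
  obtain ⟨-, -, -, -, h16, h17⟩ := hU
  have hgens := hB.two_mul_gens_lt
  have hi := i.2
  have hj := j.2
  apply det_seq
  apply det_clear.2
  apply det_seq
  refine det_pushLetter (i := S.presN.pres.gens + i) (d := Data.ofInt (-1)) (W := W) (by decide)
    (by simpa [Function.update_apply] using h4) (by simpa [Function.update_apply] using h17)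
    (by omega) (by decide) ?_
  intro s₁ t₁ h6 hs₁ ht₁
  apply det_seq
  refine det_pushLetter (i := j) (d := Data.ofInt 1) (W := W) (by decide)
    (by rw [hs₁ 8 (by decide) (by decide)]; simpa [Function.update_apply] using h8)
    (by rw [hs₁ 16 (by decide) (by decide)]; simpa [Function.update_apply] using h16)
    (by omega) (by decide) ?_
  intro s₂ t₂ h6₂ hs₂ ht₂
  apply det_seq
  refine det_pushLetter (i := S.presN.pres.gens + i) (d := Data.ofInt 1) (W := W) (by decide)
    (by rw [hs₂ 4 (by decide) (by decide), hs₁ 4 (by decide) (by decide)]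
        simpa [Function.update_apply] using h4)
    (by rw [hs₂ 16 (by decide) (by decide), hs₁ 16 (by decide) (by decide)]
        simpa [Function.update_apply] using h16)
    (by omega) (by decide) ?_
  intro s₃ t₃ h6₃ hs₃ ht₃
  have hs : ∀ r, r ≠ 6 → r ≠ 14 → s₃ r = s r := by
    intro r hr hr'
    rw [hs₃ r hr hr', hs₂ r hr hr', hs₁ r hr hr', Function.update_of_ne hr]
  have h6' : s₃ 6 = (S.conjWord i j).encode := by
    rw [h6₃, h6₂, h6, Function.update_self]
    rfl
  apply det_seq
  apply det_push.2
  apply det_seq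
  apply det_clear.2
  apply det_push.2
  refine ⟨?_, ?_, ?_, ?_, ?_⟩
  · simp [h6', hs 7]
  · simp [hs 8, h8, Data.ofNat_succ]
  · simp [hs 4]
  · intro r hr
    have hne : r ≠ 6 ∧ r ≠ 7 ∧ r ≠ 8 ∧ r ≠ 9 ∧ r ≠ 14 := by
      refine ⟨?_, ?_, ?_, ?_, ?_⟩ <;> rintro rfl <;> simp at hr
    rw [Function.update_of_ne hne.2.2.1, Function.update_of_ne hne.2.2.2.1,
      Function.update_of_ne hne.2.1, hs r hne.1 hne.2.2.2.2]
  · have := size_conjWord_le hB i j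
    simp only [h6', Function.update_self, Data.size]
    omega

theorem det_collectWords (hB : S.BoundedBy W) {s : Store} (hU : S.Unpacked s)
    (h30 : S.boxG.decode (s 30) = some 1)
    {cs : Fin (S.presN.pres.gens + S.presH.pres.gens) → Data}
    (h32 : s 32 = Data.ofList (List.ofFn cs).reverse)
    (hcs : ∀ i, S.boxG.decode (cs i) = some (γ i)) :
    Det S.env collectWords s fun s' t => (S.Unpacked s' ∧ S.HoldsGens γ s' ∧
      S.boxG.decode (s' 3) = some 1 ∧ s' 33 = .nil ∧
      Collected S.kernelWords (S.presH.pres.rels.length + S.presH.pres.gens * S.presN.pres.gens)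
        S.kernelWords s') ∧ t ≤ 200 * W ^ 3 := by
  have hW := hB.one_le
  have hgens := hB.two_mul_gens_lt
  have hsz30 := hB.sizeG _ _ h30
  obtain ⟨h31, h2, -, h0, -, -⟩ := id hU
  apply det_seq
  apply det_clear.2
  apply det_seq
  refine (det_prepend (by decide)).mono ?_
  rintro s₁ t₁ ⟨h6, hs₁, ht₁⟩
  apply det_seq
  apply det_copy.2
  apply det_seq
  apply det_clear.2
  rw [Function.update_of_ne (by decide), Function.update_self, h32, Data.toList_ofList,
    List.reverse_reverse, Data.toList, List.append_nil] at h6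
  set s₂ := Function.update (Function.update s₁ 32 (s₁ 6)) 7 .nil with hs₂def
  have hk₂ : Keep [0, 1, 2, 16, 17, 30, 31] s s₂ := by
    intro r hr
    have hne : r ≠ 5 ∧ r ≠ 6 ∧ r ≠ 7 ∧ r ≠ 32 := by
      refine ⟨?_, ?_, ?_, ?_⟩ <;> rintro rfl <;> simp at hr
    rw [hs₂def, Function.update_of_ne hne.2.2.1, Function.update_of_ne hne.2.2.2,
      hs₁ r hne.2.1 hne.1, Function.update_of_ne hne.2.1]
  have hG₂ : S.HoldsGens γ s₂ :=
    ⟨by rw [hk₂ 30 (by decide), h30], cs, by simp [hs₂def, h6], hcs⟩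
  have hU₂ : S.Unpacked s₂ := hU.keep (hk₂.mono (by decide))
  have hsz32 := hG₂.size_le hB rfl
  have h6sz : (s₁ 6).size ≤ W := by
    simpa [hs₂def] using hsz32
  have h32sz : (s 32).size ≤ W := by
    rw [h32, Data.size_ofList, List.map_reverse, List.sum_reverse, ← Data.size_ofList, ← h6]
    exact h6sz
  apply det_seq
  refine det_forEach (fun l s' => ∃ ts : List (Word S.presH.pres.gens), l = ts.map Word.encode ∧
    ts ⊆ S.presH.pres.rels ∧ ts.length ≤ S.presH.pres.rels.length ∧
    Collected S.kernelWords (S.presH.pres.rels.length - ts.length)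
      {v | ∃ t ∈ S.presH.pres.rels, t ∉ ts ∧ v = t.mapGens (Fin.natAdd _)} s' ∧
    Keep [0, 1, 2, 16, 17, 30, 31, 32] s₂ s') (15 * W) ?_ ?_ ?_
  · refine ⟨S.presH.pres.rels, ?_, List.Subset.refl _, le_rfl, ⟨[], ?_, ?_, ?_, ?_⟩, Keep.refl _⟩
    · rw [hk₂ 0 (by decide), h0, Data.toList_ofList]
    · simp [hs₂def, Data.ofList]
    · simp
    · simp
    · rintro v ⟨t, ht, ht', -⟩
      exact absurd ht ht'
  · rintro d l s' ⟨ts, hl, hts, hlen, hcol, hk⟩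
    obtain ⟨τ, ts, rfl⟩ : ∃ τ ts', ts = τ :: ts' := by
      cases ts with
      | nil => simp at hl
      | cons τ ts => exact ⟨_, _, rfl⟩
    simp only [List.map_cons, List.cons.injEq] at hl
    obtain ⟨rfl, rfl⟩ := hl
    have hk' : Keep [0, 1, 2, 16, 17, 30, 31, 32] s₂ (Function.update s' 10 τ.encode) :=
      hk.update (by decide) _
    apply det_seq
    refine (det_shiftWord (by rw [hk' 31 (by decide), hk₂ 31 (by decide), h31]) hgens.1 τ
      (by simp)).mono ?_
    rintro s₃ t₃ ⟨h11, hs₃, ht₃⟩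
    apply det_push.2
    refine ⟨⟨ts, rfl, fun t ht => hts (by simp [ht]), by simp at hlen; omega, ?_,
      (hk'.trans (hs₃.keep (by decide))).update (by decide) _⟩, ?_⟩
    · rw [List.length_cons] at hlen hcol
      rw [show S.presH.pres.rels.length - ts.length =
        S.presH.pres.rels.length - (ts.length + 1) + 1 by omega]
      refine hcol.push (v := τ.mapGens (Fin.natAdd _)) (Or.inl ⟨τ, hts (by simp), rfl⟩) ?_ ?_
      · rw [Function.update_self, h11, hs₃ 7 (by decide), Function.update_of_ne (by decide)]
      · rintro w ⟨t, ht, hnt, rfl⟩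
        by_cases hτ : t = τ
        · exact Or.inl (by rw [hτ])
        · exact Or.inr ⟨t, ht, by simp [hτ, hnt], rfl⟩
    · have h1 := size_encode_mapGens_natAdd hgens.1 τ
      rw [h11]
      have h2 : 15 * W * (1 + τ.encode.size) = 13 * W * τ.encode.size + W * τ.encode.size +
        W * τ.encode.size + 15 * W := by ring
      omega
  rintro s₃ t₃ ⟨ts, hl, -, -, hcol, hk₃⟩ ht₃
  obtain rfl : ts = [] := by simpa using hl.symm
  rw [hk₂ 0 (by decide)] at ht₃
  have hsz0 : (s 0).size ≤ W := by
    have := hB.presH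
    simp only [Presentation.encode, Data.size] at this
    rw [h0]; omega
  apply det_seq
  apply det_copy.2
  rw [hk₃ 31 (by decide), hk₂ 31 (by decide), h31, Data.size_ofNat]
  apply det_seq
  refine det_forEachNat (n := S.presH.pres.gens) ?_ (fun i s' =>
    s' 4 = Data.ofNat (S.presN.pres.gens + i) ∧ Keep [0, 1, 2, 16, 17, 30, 31, 32] s₂ s' ∧
    Collected S.kernelWords (S.presH.pres.rels.length + i * S.presN.pres.gens)
      {v | (∃ t ∈ S.presH.pres.rels, v = t.mapGens (Fin.natAdd _)) ∨
        ∃ (a : Fin S.presH.pres.gens) (b : Fin S.presN.pres.gens),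
          (a : ℕ) < i ∧ v = S.conjWord a b} s') (145 * W ^ 2) ?_ ?_ ?_
  · rw [Function.update_of_ne (by decide), hk₃ 2 (by decide), hk₂ 2 (by decide), h2]
  · refine ⟨by simp, hk₃.update (by decide) _, hcol.congr (by simp) (by simp) ?_⟩
    rintro v (⟨t, ht, rfl⟩ | ⟨a, b, ha, -⟩)
    · exact ⟨t, ht, by simp, rfl⟩
    · omega
  · rintro i s' hi ⟨h4, hk, hcol⟩
    apply det_seq
    apply det_clear.2
    apply det_seq
    refine det_forEachNat (n := S.presN.pres.gens) ?_ (fun j s' =>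
      s' 8 = Data.ofNat j ∧ s' 4 = Data.ofNat (S.presN.pres.gens + i) ∧
      Keep [0, 1, 2, 16, 17, 30, 31, 32] s₂ s' ∧
      Collected S.kernelWords (S.presH.pres.rels.length + i * S.presN.pres.gens + j)
        {v | (∃ t ∈ S.presH.pres.rels, v = t.mapGens (Fin.natAdd _)) ∨
          ∃ (a : Fin S.presH.pres.gens) (b : Fin S.presN.pres.gens),
            ((a : ℕ) < i ∨ (a : ℕ) = i ∧ (b : ℕ) < j) ∧ v = S.conjWord a b} s')
      (140 * W) ?_ ?_ ?_
    · rw [Function.update_of_ne (by decide), Function.update_of_ne (by decide), hk 31 (by decide),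
        hk₂ 31 (by decide), h31]
    · refine ⟨by simp [Data.ofNat, Data.ofList], by simpa using h4,
        (hk.update (by decide) _).update (by decide) _,
        hcol.congr (by simp) rfl ?_⟩
      rintro v (ht | ⟨a, b, hab, rfl⟩)
      · exact Or.inl ht
      · exact Or.inr ⟨a, b, by omega, rfl⟩
    · rintro j s₄ hj ⟨h8, h4, hk₄, hcol⟩
      have hk₄' := hk₄.update (x := 9) (by decide) .nil
      refine (det_collectConj hB (hU₂.keep (hk₄'.mono (by decide))) (i := ⟨i, hi⟩) (j := ⟨j, hj⟩)
        (by simpa using h4) (by simpa using h8)).mono ?_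
      rintro s₅ t₅ ⟨h7, h8', h4', hk₅, ht₅⟩
      refine ⟨⟨h8', ?_, hk₄'.trans hk₅, hcol.push (v := S.conjWord ⟨i, hi⟩ ⟨j, hj⟩)
        (Or.inr ⟨_, _, rfl⟩) (by simpa using h7) ?_⟩, ht₅⟩
      · rw [h4']; simpa using h4
      · rintro v (ht | ⟨a, b, hab, rfl⟩)
        · exact Or.inr (Or.inl ht)
        · by_cases hlt : (a : ℕ) < i ∨ (a : ℕ) = i ∧ (b : ℕ) < j
          · exact Or.inr (Or.inr ⟨a, b, hlt, rfl⟩)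
          · have hai : (a : ℕ) = i := by omega
            have hbj : (b : ℕ) = j := by omega
            obtain rfl : a = ⟨i, hi⟩ := Fin.ext hai
            obtain rfl : b = ⟨j, hj⟩ := Fin.ext hbj
            exact Or.inl rfl
    · rintro s₄ t₄ ⟨-, h4, hk₄, hcol⟩ ht₄
      apply det_seq
      apply det_clear.2
      apply det_push.2
      refine ⟨⟨?_, (hk₄.update (by decide) _).update (by decide) _,
        hcol.congr (by simp) (by ring) ?_⟩, ?_⟩
      · simp [h4, ← add_assoc, Data.ofNat_succ]
      · rintro v (ht | ⟨a, b, hab, rfl⟩)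
        · exact Or.inl ht
        · exact Or.inr ⟨a, b, by omega, rfl⟩
      · have := Nat.mul_le_mul_left (1 + 140 * W) hgens.1
        simp only [Function.update_self, Data.size]
        nlinarith
  rintro s₄ t₄ ⟨-, hk₄, hcol⟩ ht₄
  apply det_seq
  apply det_clear.2
  apply det_copy.2
  have hk₅ : Keep [0, 1, 2, 16, 17, 30, 31, 32] s₂ (Function.update (Function.update s₄ 33 .nil) 3
      ((Function.update s₄ 33 .nil) 30)) := (hk₄.update (by decide) _).update (by decide) _
  have h30' : Function.update s₄ 33 .nil 30 = s 30 := by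
    rw [Function.update_of_ne (by decide), hk₄ 30 (by decide), hk₂ 30 (by decide)]
  refine ⟨⟨hU₂.keep (hk₅.mono (by decide)), hG₂.keep (hk₅.mono (by decide)), ?_, by simp,
    hcol.congr (by simp) rfl ?_⟩, ?_⟩
  · rw [Function.update_self, h30', h30]
  · rintro v (ht | ⟨a, b, rfl⟩)
    · exact Or.inl ht
    · exact Or.inr ⟨a, b, a.2, rfl⟩
  · rw [h30']
    rw [Function.update_of_ne (by decide)] at ht₁
    have h1 := Nat.mul_le_mul_left (1 + 145 * W ^ 2) hgens.2
    have h2 := Nat.mul_le_mul_left (1 + 15 * W) hsz0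
    have h3 : W ≤ W ^ 3 := Nat.le_self_pow (by decide) W
    have h4 : W ^ 2 ≤ W ^ 3 := Nat.pow_le_pow_right hW (by decide)
    nlinarith

/-- Turn all words in register `7` into relators, by completing them to words for `1`, and collect
these in register `33`. -/
def collectRels : Prog Subroutine := .forEach 11 7 (.seq completeWord (.push 33 11))

/-- Add the relators of `N`, and write the presentation and the auxiliary datum to register `0`. -/
def writeOutput : Prog Subroutine :=
  .block [.forEach 5 1 (.push 33 5), .copy 3 31, .forEach 5 2 (.push 3 5), .push 33 3,
    .copy 0 32, .push 0 31, .push 0 30, .push 0 33]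

/-- The program that constructs the presentation of the extension. -/
def constructProg : Prog Subroutine :=
  .seq unpackInput (.seq chooseGens (.seq collectWords (.seq collectRels writeOutput)))

/-- The list of relators has random length; its potential has slope `2` since the list is written
once more and is part of the output. -/
theorem triple_collectRels (hB : S.BoundedBy W) (hL : S.Lifts αN αH γ) {s : Store}
    (hG : S.HoldsGens γ s) (h3 : S.boxG.decode (s 3) = some 1) (h33 : s 33 = .nil)
    {n : ℕ} (hcol : Collected S.kernelWords n S.kernelWords s) (c : ℕ) :
    Triple S.env collectRels s
      (fun s' => ∃ rs : List (Word (S.presN.pres.gens + S.presH.pres.gens)),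
        s' 33 = Data.ofList (rs.map Word.encode) ∧ rs.length = n ∧ (∀ r ∈ rs, r.eval γ = 1) ∧
        (∀ v ∈ S.kernelWords, ∃ u : Word S.presN.pres.gens,
          u.mapGens (Fin.castAdd _) ++ v ∈ rs) ∧ Keep [1, 2, 3, 30, 31, 32] s s')
      (fun s' => (2 * (s' 33).size + c : ℕ)) (3 + n * (3500 * W ^ 3) + c : ℕ) := by
  obtain ⟨ks, h7, hlen, hA, hM⟩ := hcol
  have hW := hB.one_le
  refine (triple_forEach (fun l s' =>
    ∃ vs rs : List (Word (S.presN.pres.gens + S.presH.pres.gens)), l = vs.map Word.encode ∧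
      s' 33 = Data.ofList (rs.map Word.encode) ∧ rs.length + vs.length = n ∧
      (∀ v ∈ vs, v ∈ S.kernelWords) ∧ (∀ r ∈ rs, r.eval γ = 1) ∧
      (∀ v ∈ ks, v ∈ vs ∨ ∃ u : Word S.presN.pres.gens, u.mapGens (Fin.castAdd _) ++ v ∈ rs) ∧
      Keep [1, 2, 3, 30, 31, 32] s s')
    (fun l s' => (l.length * (3500 * W ^ 3) + (2 * (s' 33).size + c) : ℕ))
    (c := (3 + n * (3500 * W ^ 3) + c : ℕ)) ?_ ?_ ?_).mono ?_ le_rfl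
  · exact ⟨ks, [], by rw [h7, Data.toList_ofList], h33, by simpa using hlen, hA, by simp,
      fun v hv => Or.inl hv, Keep.refl s⟩
  · rintro d l s' ⟨vs, rs, hl, h33, hlen, hvs, hrs, hks, hk⟩
    obtain ⟨v, vs, rfl⟩ : ∃ v vs', vs = v :: vs' := by
      cases vs with
      | nil => simp at hl
      | cons v vs => exact ⟨_, _, rfl⟩
    simp only [List.map_cons, List.cons.injEq] at hl
    obtain ⟨rfl, rfl⟩ := hl
    have hv := hvs v (by simp)
    have hk' : Keep [1, 2, 3, 30, 31, 32] s (Function.update s' 11 v.encode) :=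
      hk.update (by decide) _
    have hT := triple_completeWord hB hL (hG.keep (hk'.mono (by decide))) v (by simp) (g := 1)
      (by rw [hk' 3 (by decide), h3]) (by rw [hL.map_eval_kernelWords hv, map_one]) 8
    -- Slope `8` pays for pushing the new relator and for its share in the potential.
    refine ⟨(((70 + 2 * 8) * W * v.encode.size : ℕ) : ℝ≥0∞) +
      ((vs.length * (3500 * W ^ 3) + (2 * (s' 33).size + c) : ℕ) : ℝ≥0∞),
      triple_seq (hT.add_const _) ?_, ?_⟩
    · rintro s₁ ⟨u, h11, hu, hs₁⟩
      have h33' : s₁ 33 = s' 33 := by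
        rw [hs₁ 33 (by decide), Function.update_of_ne (by decide)]
      refine (det_push (Q := fun s₂ t => s₂ = _ ∧ t = _)).2 ⟨rfl, rfl⟩ |>.triple ?_
      rintro s₂ t ⟨rfl, rfl⟩
      refine ⟨⟨vs, (u.mapGens (Fin.castAdd _) ++ v) :: rs, rfl, ?_, ?_, ?_, ?_, ?_,
        (hk'.trans (hs₁.keep (by decide))).update (by decide) _⟩, ?_⟩
      · rw [Function.update_self, h11, h33', h33]; rfl
      · simp only [List.length_cons] at hlen ⊢; omega
      · exact fun w hw => hvs w (by simp [hw])
      · intro r hr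
        rcases List.mem_cons.1 hr with rfl | hr
        · exact hu
        · exact hrs r hr
      · intro w hw
        rcases hks w hw with hw | ⟨u', hu'⟩
        · rcases List.mem_cons.1 hw with rfl | hw
          · exact Or.inr ⟨u, by simp⟩
          · exact Or.inl hw
        · exact Or.inr ⟨u', by simp [hu']⟩
      · rw [Function.update_self, h33', Data.size, List.length_map]
        have h1 := (s₁ 11).one_le_size
        have : 1 + (s₁ 11).size + (vs.length * (3500 * W ^ 3) +
            (2 * (1 + (s₁ 11).size + (s' 33).size) + c)) ≤
            8 * (s₁ 11).size + (vs.length * (3500 * W ^ 3) + (2 * (s' 33).size + c)) := by omega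
        exact_mod_cast this
    · have h1 := size_kernelWord_le hB hv
      have h2 : 1 + v.encode.size + ((70 + 2 * 8) * W * v.encode.size +
          (vs.length * (3500 * W ^ 3) + (2 * (s' 33).size + c))) ≤
          (v.encode :: vs.map Word.encode).length * (3500 * W ^ 3) + (2 * (s' 33).size + c) := by
        rw [List.length_cons, List.length_map, Nat.succ_mul]
        have h3 := Nat.mul_le_mul_left (86 * W) h1
        have h4 : W ^ 2 ≤ W ^ 3 := Nat.pow_le_pow_right hW (by decide)
        have h5 : 1 ≤ W ^ 3 := Nat.one_le_pow _ _ hW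
        nlinarith
      exact_mod_cast h2
  · rw [h7, Data.toList_ofList, h33, List.length_map, hlen]
    have : 1 + (n * (3500 * W ^ 3) + (2 * Data.nil.size + c)) ≤ 3 + n * (3500 * W ^ 3) + c := by
      simp only [Data.size]; omega
    exact_mod_cast this
  · rintro s' ⟨vs, rs, hl, h33, hlen, -, hrs, hks, hk⟩
    obtain rfl : vs = [] := by simpa using hl.symm
    refine ⟨⟨rs, h33, hlen, hrs, fun v hv => ?_, hk⟩, by simp⟩
    simpa using hks v (hM v hv)

theorem det_writeOutput (hB : S.BoundedBy W) {s : Store}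
    (h31 : s 31 = Data.ofNat S.presN.pres.gens) (h2 : s 2 = Data.ofNat S.presH.pres.gens)
    (h1 : s 1 = Data.ofList (S.presN.pres.rels.map Word.encode)) (hG : S.HoldsGens γ s)
    {rs : List (Word (S.presN.pres.gens + S.presH.pres.gens))}
    (h33 : s 33 = Data.ofList (rs.map Word.encode)) :
    Det S.env writeOutput s fun s' t => (∃ aux, S.IsAux γ aux ∧ s' 0 = .pair
      (Presentation.mk (S.presN.pres.gens + S.presH.pres.gens)
        ((S.presN.pres.rels.map (Word.mapGens (Fin.castAdd _))).reverse ++ rs)).encode aux) ∧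
      t + (s' 0).size ≤ 2 * (s 33).size + 40 * W := by
  have hW := hB.one_le
  have hgens := hB.two_mul_gens_lt
  have hz32 := hG.size_le hB rfl
  have hz30 := hB.sizeG _ _ hG.1
  have hz1 : (s 1).size ≤ W := by
    have := hB.presN
    simp only [Presentation.encode, Data.size] at this
    rw [h1]; omega
  apply det_seq
  refine (det_prepend (by decide)).mono ?_
  rintro s₁ t₁ ⟨h33₁, hs₁, ht₁⟩
  apply det_seq
  apply det_copy.2
  apply det_seq
  refine (det_prepend (by decide)).mono ?_
  rintro s₂ t₂ ⟨h3, hs₂, ht₂⟩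
  have hs : ∀ r, r ≠ 3 → r ≠ 5 → r ≠ 33 → s₂ r = s r := by
    intro r h3 h5 h33
    rw [hs₂ r h3 h5, Function.update_of_ne h3, hs₁ r h33 h5]
  have h33₂ : s₂ 33 = Data.ofList
      (((S.presN.pres.rels.map (Word.mapGens (Fin.castAdd S.presH.pres.gens))).reverse ++ rs).map
        Word.encode) := by
    rw [hs₂ 33 (by decide) (by decide), Function.update_of_ne (by decide), h33₁, h1, h33,
      Data.toList_ofList, Data.toList_ofList, List.map_append, List.map_reverse, List.map_map]
    congr 4
    funext u
    exact (Word.encode_mapGens_castAdd u).symm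
  have h3' : s₂ 3 = Data.ofNat (S.presN.pres.gens + S.presH.pres.gens) := by
    rw [h3, Function.update_self, Function.update_of_ne (by decide),
      hs₁ 2 (by decide) (by decide), hs₁ 31 (by decide) (by decide), h2, h31]
    simp [Data.ofNat, Data.toList_ofList, add_comm]
  iterate 4
    apply det_seq
    first | apply det_push.2 | apply det_copy.2
  apply det_push.2
  obtain ⟨h30, cs, h32, hcs⟩ := hG
  refine ⟨⟨_, ⟨s 30, cs, rfl, h30, hcs⟩, ?_⟩, ?_⟩
  · simp [h33₂, h3', hs 30, hs 31, hs 32, h31, h32, Presentation.encode]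
  · have hz33 : (s₂ 33).size + 1 = (s 1).size + (s 33).size := by
      rw [hs₂ 33 (by decide) (by decide), Function.update_of_ne (by decide), h33₁]
      rw [Data.size_ofList_append, Data.ofList_toList]
      congr 1
      rw [Data.size_ofList, List.map_reverse, List.sum_reverse, ← Data.size_ofList,
        Data.ofList_toList]
    have hz31 : (s 31).size ≤ W := by rw [h31, Data.size_ofNat]; omega
    have hz2 : (s 2).size ≤ W := by rw [h2, Data.size_ofNat]; omega
    have hz3 : (s₂ 3).size ≤ 2 * W := by rw [h3', Data.size_ofNat]; omega
    rw [Function.update_of_ne (by decide), hs₁ 2 (by decide) (by decide)] at ht₂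
    have hz31' : (s₁ 31).size ≤ W := by rwa [hs₁ 31 (by decide) (by decide)]
    simp [hs 30, hs 31, hs 32, Data.size]
    omega

theorem triple_constructProg (hB : S.BoundedBy W) (hC : S.Compatible αN αH) {s : Store}
    (h0 : s 0 = S.input) :
    Triple S.env constructProg s (fun s' => ∃ γ rels aux, S.Lifts αN αH γ ∧ S.IsAux γ aux ∧
      s' 0 = .pair (Presentation.mk (S.presN.pres.gens + S.presH.pres.gens) rels).encode aux ∧
      (∀ r ∈ rels, r.eval γ = 1) ∧
      (∀ u ∈ S.presN.pres.rels, u.mapGens (Fin.castAdd _) ∈ rels) ∧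
      (∀ v ∈ S.kernelWords, ∃ u : Word S.presN.pres.gens,
        u.mapGens (Fin.castAdd _) ++ v ∈ rels) ∧
      rels.length = S.presN.pres.rels.length + S.presH.pres.rels.length +
        S.presH.pres.gens * S.presN.pres.gens)
      (fun s' => (s' 0).size) (8000 * W ^ 5 : ℕ) := by
  have hW := hB.one_le
  set n := S.presH.pres.rels.length + S.presH.pres.gens * S.presN.pres.gens with hn
  refine (det_unpackInput hB h0).triple_seq (50 * W)
    (c' := (130 * W ^ 2 + (200 * W ^ 3 + (3 + n * (3500 * W ^ 3) + 40 * W)) : ℕ))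
    (fun _ _ h => h.2.2.2.2) ?_ ?_
  · rintro s₁ - ⟨hU, h3, h4, h32, -⟩
    refine triple_seq (((triple_chooseGens hB hC hU h3 h4 h32).add_const
      ((200 * W ^ 3 + (3 + n * (3500 * W ^ 3) + 40 * W) : ℕ) : ℝ≥0∞)).mono (fun s' h => ⟨h, le_rfl⟩)
        (by push_cast; exact le_rfl)) ?_
    rintro s₂ ⟨hU, h30, γ, cs, hL, h32, hcs⟩
    rw [zero_add]
    refine (det_collectWords hB hU h30 h32 hcs).triple_seq (200 * W ^ 3)
      (c' := (3 + n * (3500 * W ^ 3) + 40 * W : ℕ)) (fun _ _ h => h.2) ?_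
      (by push_cast; exact le_rfl)
    rintro s₃ - ⟨⟨hU, hG, h3, h33, hcol⟩, -⟩
    refine triple_seq (triple_collectRels hB hL hG h3 h33 hcol (40 * W)) ?_
    rintro s₄ ⟨rs, h33, hlen, hrs, hks, hk⟩
    obtain ⟨h31, h2, h1, -, -, -⟩ := hU
    refine (det_writeOutput hB (by rw [hk 31 (by decide), h31]) (by rw [hk 2 (by decide), h2])
      (by rw [hk 1 (by decide), h1]) (hG.keep (hk.mono (by decide))) h33).triple ?_
    rintro s₅ t ⟨⟨aux, haux, h0⟩, ht⟩
    refine ⟨⟨γ, _, aux, hL, haux, h0, ?_, ?_, ?_, ?_⟩, by exact_mod_cast ht⟩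
    · intro r hr
      rcases List.mem_append.1 hr with hr | hr
      · obtain ⟨u, hu, rfl⟩ := List.mem_map.1 (List.mem_reverse.1 hr)
        rw [hL.eval_castAdd, Presentation.classOf_eq_one hu, map_one, map_one]
      · exact hrs r hr
    · exact fun u hu => List.mem_append_left _ (List.mem_reverse.2 (List.mem_map_of_mem hu))
    · intro v hv
      obtain ⟨u, hu⟩ := hks v hv
      exact ⟨u, List.mem_append_right _ hu⟩
    · rw [List.length_append, List.length_reverse, List.length_map, hlen, add_assoc]
  · have hgens := hB.two_mul_gens_lt
    have hrels : S.presH.pres.rels.length ≤ W := by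
      have h1 := hB.presH
      simp only [Presentation.encode, Data.size, Data.size_ofList, List.map_map] at h1
      have h2 : S.presH.pres.rels.length ≤ (S.presH.pres.rels.map
          ((fun d => 1 + d.size) ∘ Word.encode)).sum := by
        have := List.card_nsmul_le_sum (S.presH.pres.rels.map
          ((fun d => 1 + d.size) ∘ Word.encode)) 1 (by
            intro x hx
            obtain ⟨t, -, rfl⟩ := List.mem_map.1 hx
            simp)
        simpa using this
      omega
    have hn' : n ≤ 2 * W ^ 2 := by
      have : S.presH.pres.gens * S.presN.pres.gens ≤ W * W :=
        Nat.mul_le_mul (by omega) (by omega)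
      nlinarith
    have h1 := Nat.mul_le_mul_right (3500 * W ^ 3) hn'
    have h2 : W ≤ W ^ 5 := Nat.le_self_pow (by decide) W
    have h3 : W ^ 2 ≤ W ^ 5 := Nat.pow_le_pow_right hW (by decide)
    have h4 : W ^ 3 ≤ W ^ 5 := Nat.pow_le_pow_right hW (by decide)
    have : 50 * W + (130 * W ^ 2 + (200 * W ^ 3 + (3 + n * (3500 * W ^ 3) + 40 * W))) ≤
        8000 * W ^ 5 := by
      have h5 : 2 * W ^ 2 * (3500 * W ^ 3) = 7000 * W ^ 5 := by ring
      omega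
    exact_mod_cast this

end Extension

/-! ### Polynomial bounds -/

theorem polynomial_eval_mono (p : Polynomial ℕ) : Monotone fun n => p.eval n := by
  intro a b hab
  induction p using Polynomial.induction_on' with
  | add p q hp hq =>
    simp only [Polynomial.eval_add] at hp hq ⊢
    exact add_le_add hp hq
  | monomial n c =>
    simp only [Polynomial.eval_monomial]
    gcongr

namespace Extension

variable {N G H : Type*} [Group N] [Group G] [Group H] {S : Extension N G H}

/-- The subroutines are called on codes, on pairs of codes and on words with at most one letter,
which all have length at most `2 s + 10`; a list of codes of all generators has at most `s` entries
of length at most `s`. -/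
theorem SizeLE.boundedBy {s : ℕ} (hs : S.SizeLE s) {p : Polynomial ℕ}
    (hp : S.RunsIn fun l => p.eval (s + l)) :
    S.BoundedBy (2 + s + s * (1 + s) + p.eval (3 * s + 10)) := by
  obtain ⟨hsN, hsG, hsH, hpN, hpH⟩ := hs
  obtain ⟨-, ⟨hG, hG'⟩, -, ⟨hι, hι'⟩, ⟨hπ, hπ'⟩, ⟨hlogN, hexpN⟩, hlogH, hexpH⟩ := hp
  have hN : ∀ c g, S.boxN.decode c = some g → c.size ≤ s :=
    fun c g h => (S.boxN.size_le c g h).trans hsN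
  have hGs : ∀ c g, S.boxG.decode c = some g → c.size ≤ s :=
    fun c g h => (S.boxG.size_le c g h).trans hsG
  have hHs : ∀ c g, S.boxH.decode c = some g → c.size ≤ s :=
    fun c g h => (S.boxH.size_le c g h).trans hsH
  have hgens : 2 * S.presN.pres.gens + 3 ≤ s ∧ 2 * S.presH.pres.gens + 3 ≤ s := by
    simp only [Presentation.encode, Data.size, Data.size_ofNat] at hpN hpH
    have := (Data.ofList (S.presN.pres.rels.map Word.encode)).one_le_size
    have := (Data.ofList (S.presH.pres.rels.map Word.encode)).one_le_size
    omega
  have heval : ∀ l, l ≤ 2 * s + 10 → p.eval (s + l) ≤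
      2 + s + s * (1 + s) + p.eval (3 * s + 10) := fun l hl =>
    (polynomial_eval_mono p (show s + l ≤ 3 * s + 10 by omega)).trans (Nat.le_add_left _ _)
  have heval' : ∀ l, l ≤ 2 * s + 10 → ((p.eval (s + l) : ℕ) : ℝ≥0∞) ≤
      ((2 + s + s * (1 + s) + p.eval (3 * s + 10) : ℕ) : ℝ≥0∞) := fun l hl => by
    exact_mod_cast heval l hl
  have hword : ∀ {n : ℕ} (i : Fin n), 2 * n + 3 ≤ s →
      (Word.encode [(i, 1)]).size ≤ 2 * s + 10 := by
    intro n i hn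
    have h7 : (Data.ofInt 1).size = 7 := by decide
    simp only [Word.encode, List.map_cons, List.map_nil, Data.ofList, Data.size,
      Data.size_ofNat, h7]
    omega
  constructor
  · omega
  · exact fun c g h => (hN c g h).trans (by omega)
  · exact fun c g h => (hGs c g h).trans (by omega)
  · exact fun c g h => (hHs c g h).trans (by omega)
  · omega
  · omega
  · intro l hl hc
    have h1 := List.sum_le_card_nsmul (l.map fun d => 1 + d.size) (1 + s) (by
      intro x hx
      obtain ⟨c, hcl, rfl⟩ := List.mem_map.1 hx
      obtain ⟨g, hg⟩ := hc c hcl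
      have := hGs c g hg
      omega)
    rw [List.length_map, smul_eq_mul] at h1
    have h2 : l.length * (1 + s) ≤ s * (1 + s) := Nat.mul_le_mul_right _ (by omega)
    rw [Data.size_ofList]
    omega
  · intro x y g h hx hy
    refine (hG x y g h hx hy).1.trans (heval _ ?_)
    have := hGs x g hx
    have := hGs y h hy
    simp only [Data.size]
    omega
  · exact fun x g hx => (hG' x g hx).trans (heval _ (by have := hGs x g hx; omega))
  · exact fun c g hc => (hι c g hc).trans (heval _ (by have := hN c g hc; omega))
  · exact fun c g hc hr => (hι' c g hc hr).trans (heval _ (by have := hGs c g hc; omega))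
  · exact fun c g hc => (hπ c g hc).trans (heval _ (by have := hGs c g hc; omega))
  · exact fun c g hc hr => (hπ' c g hc hr).trans (heval _ (by have := hHs c g hc; omega))
  · exact fun c g hc => (hlogN c g hc).trans (heval' _ (by have := hN c g hc; omega))
  · exact fun c g hc => (hlogH c g hc).trans (heval' _ (by have := hHs c g hc; omega))
  · exact (hexpN []).trans (heval' _ (by
      simp only [Word.encode, List.map_nil, Data.ofList, Data.size]; omega))
  · exact fun i => (hexpN _).trans (heval' _ (hword i hgens.1))
  · exact fun i => (hexpH _).trans (heval' _ (hword i hgens.2))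

end Extension

end BlackBox

theorem mainTheorem3 :
    -- one algorithm for all extensions: it constructs the presentation (with auxiliary data) and
    -- provides the discrete logarithm and the exponential map
    ∃ construct logG expG : Prog Subroutine,
      ∀ p : Polynomial ℕ, ∃ q : Polynomial ℕ,
        ∀ (N G H : Type*) [Group N] [Group G] [Group H] (S : Extension N G H) (s : ℕ),
          S.SizeLE s → S.RunsIn (fun l => p.eval (s + l)) →
          (construct.exec S.env).expectedTime S.input ≤ ((q.eval s : ℕ) : ENNReal) ∧
          ∀ o ∈ (construct.exec S.env S.input).support,
            ∃ (E : EffectivePresentation S.boxG) (aux : Data),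
              o.1 = Data.pair E.pres.encode aux ∧
              E.log = (fun c => logG.exec S.env (Data.pair aux c)) ∧
              E.exp = (fun w => expG.exec S.env (Data.pair aux w)) ∧
              E.RunsIn (fun l => q.eval (s + l)) ∧
              E.pres.gens ≤ S.presH.pres.gens + S.presN.pres.gens ∧
              E.pres.rels.length ≤ S.presN.pres.rels.length + S.presH.pres.rels.length +
                S.presH.pres.gens * S.presN.pres.gens := by
  refine ⟨Extension.constructProg, Extension.logProg, Extension.expProg, fun p => ?_⟩
  -- The polynomial bound of `SizeLE.boundedBy`.
  let Wp : Polynomial ℕ := 2 + .X + .X * (1 + .X) + p.comp (3 * .X + 10)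
  have hWp : ∀ s, Wp.eval s = 2 + s + s * (1 + s) + p.eval (3 * s + 10) := by
    intro s
    simp [Wp, Polynomial.eval_comp]
  refine ⟨8000 * Wp ^ 5 + 120 * Wp ^ 3 + 70 * Wp * .X, ?_⟩
  intro N G H _ _ _ S s hs hr
  have hB := hs.boundedBy hr
  rw [← hWp] at hB
  have hq : ∀ n, (8000 * Wp ^ 5 + 120 * Wp ^ 3 + 70 * Wp * .X : Polynomial ℕ).eval n =
      8000 * Wp.eval n ^ 5 + 120 * Wp.eval n ^ 3 + 70 * Wp.eval n * n := by
    intro n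
    simp
  obtain ⟨αN, hlogN, hexpN⟩ := S.presN.correct
  obtain ⟨αH, hlogH, hexpH⟩ := S.presH.correct
  obtain ⟨hsupp, htime⟩ := (Extension.triple_constructProg hB ⟨hlogN, hexpN, hlogH, hexpH⟩
    (Function.update_self ..)).exec
  refine ⟨htime.trans ?_, fun o ho => ?_⟩
  · rw [hq]
    exact_mod_cast (Nat.le_add_right _ _).trans (Nat.le_add_right _ _)
  obtain ⟨s', ⟨γ, rels, aux, hL, haux, h0, hrel, hU, hK, hlen⟩, ho⟩ := hsupp o ho
  have : Finite N := S.boxN.finite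
  obtain ⟨α, hα⟩ := exists_mulEquiv_of_extension S.ι_injective S.exact αN αH γ hL.left hL.right
    rels hrel hU (fun t ht => hK _ (Or.inl ⟨t, ht, rfl⟩)) (fun i j => hK _ (Or.inr ⟨i, j, rfl⟩))
  refine ⟨⟨⟨S.presN.pres.gens + S.presH.pres.gens, rels⟩,
    fun c => Extension.logProg.exec S.env (.pair aux c),
    fun w => Extension.expProg.exec S.env (.pair aux w), α, ?_, ?_⟩, aux, ho.trans h0, rfl, rfl,
    ⟨?_, ?_⟩, (Nat.add_comm _ _).le, hlen.le⟩
  · intro c g hc o ho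
    obtain ⟨w, hw, hwg⟩ := (Extension.exec_logProg hB hL haux hc).1 o ho
    exact ⟨w, hw, α.symm.injective (by rw [hα, hwg, MulEquiv.symm_apply_apply])⟩
  · intro w o ho
    rw [hα]
    exact (Extension.exec_expProg hB haux w).1 o ho
  · intro c g hc
    refine (Extension.exec_logProg hB hL haux hc).2.trans ?_
    have h1 := polynomial_eval_mono Wp (Nat.le_add_right s c.size)
    have h2 : 120 * Wp.eval s ^ 3 ≤ 120 * Wp.eval (s + c.size) ^ 3 :=
      Nat.mul_le_mul_left _ (Nat.pow_le_pow_left h1 3)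
    simp only [hq]
    exact_mod_cast h2.trans ((Nat.le_add_left _ _).trans (Nat.le_add_right _ _))
  · intro w
    refine (Extension.exec_expProg hB haux w).2.trans ?_
    have h1 := polynomial_eval_mono Wp (Nat.le_add_right s w.encode.size)
    have h2 : 70 * Wp.eval s * w.encode.size ≤
        70 * Wp.eval (s + w.encode.size) * (s + w.encode.size) :=
      Nat.mul_le_mul (Nat.mul_le_mul_left _ h1) (Nat.le_add_left _ _)
    simp only [hq]
    exact_mod_cast h2.trans (Nat.le_add_left _ _)
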